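/- An $8$-hedrite is a finite $2$-connected (loopless; multiple edges allowed) $4$-valent plane graph all of whose faces are $3$-gons or $4$-gons (it then has exactly eight $3$-gons). A central circuit of a $4$-valent plane graph is a circuit obtained by starting with an edge and continuing at each vertex along the edge opposite to the entering one, until it closes up. Each of the two directions of traversal of a central circuit singles out one of its two sides, namely the left-hand one; the circuit is incident on that side to a face $F$ if $F$ lies to the left of one of its edges in this traversal. A rail-road is a circuit of $4$-gonal faces, possibly self-intersecting, in which every $4$-gon is adjacent to its two neighbours on opposite edges. An $8$-hedrite is irreducible if it contains no rail-road. Deleting a central circuit $C'$ from a $4$-valent plane graph means removing all edges of $C'$ and all vertices through which $C'$ passes twice, and smoothing the vertices of degree $2$ that are left where $C'$ crosses other central circuits. **Lemma.** Let $G$ be an irreducible $8$-hedrite and let $C$ be a central circuit of $G$ that is incident to (at least) three distinct $3$-gons on one of its sides. Then a new central circuit can be added to $G$ so that the result is again an irreducible $8$-hedrite: there are an irreducible $8$-hedrite $G'$ and a (possibly self-intersecting) central circuit $C'$ of $G'$ such that deleting $C'$ from $G'$ gives the plane graph $G$. -/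

import Mathlib

universe u v

/-- The set of cycles (orbits) of a permutation, fixed points included. -/
abbrev PermCycles {D : Type u} (p : Equiv.Perm D) : Type u :=
  Quotient (Equiv.Perm.SameCycle.setoid p)

/-- A finite connected plane graph (loops and multiple edges allowed), encoded in the standard way
by its rotation system on the set `D` of darts. A dart is an edge together with one of
its two directions, and it is regarded as starting at its tail.
`rot d` is the next dart, counterclockwise, among those with the same tail as `d`;
`inv d` is the same edge with the opposite direction. Vertices are the cycles of `rot`, edges those
of `inv`, and faces those of `rot⁻¹ * inv`, which runs along the boundary
of a face that is kept on the left. Euler's formula says that the underlying surface is a sphere. -/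
structure PlaneGraph (D : Type u) where
  rot : Equiv.Perm D
  inv : Equiv.Perm D
  finite : Finite D
  inv_inv : ∀ d, inv (inv d) = d
  inv_ne : ∀ d, inv d ≠ d
  connected : ∀ d e, ∃ g ∈ Subgroup.closure {rot, inv}, g d = e
  euler : Nat.card (PermCycles rot) + Nat.card (PermCycles (rot⁻¹ * inv)) =
    Nat.card (PermCycles inv) + 2

namespace PlaneGraph

variable {D : Type u} {D' : Type v}

/-- The next dart on the boundary of the face to the left. -/
def faceNext (G : PlaneGraph D) : Equiv.Perm D := G.rot⁻¹ * G.inv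

abbrev Vertex (G : PlaneGraph D) : Type u := PermCycles G.rot

abbrev Face (G : PlaneGraph D) : Type u := PermCycles G.faceNext

/-- The tail of a dart. -/
def tail (G : PlaneGraph D) (d : D) : G.Vertex := Quotient.mk _ d

/-- The face to the left of a dart. -/
def leftFace (G : PlaneGraph D) (d : D) : G.Face := Quotient.mk _ d

/-- The degree (valency) of a vertex; a loop counts twice. -/
noncomputable def degree (G : PlaneGraph D) (x : G.Vertex) : ℕ := {d : D | G.tail d = x}.ncard

/-- `G.gonality F = k` means that the face `F` is a `k`-gon (an edge with `F` on both sides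
counts twice). -/
noncomputable def gonality (G : PlaneGraph D) (F : G.Face) : ℕ := {d : D | G.leftFace d = F}.ncard

/-- The number `p_k` of `k`-gonal faces. -/
noncomputable def numFaces (G : PlaneGraph D) (k : ℕ) : ℕ := {F : G.Face | G.gonality F = k}.ncard

/-- The underlying simple graph: loops are dropped, parallel edges are identified. -/
def skeleton (G : PlaneGraph D) : SimpleGraph G.Vertex :=
  SimpleGraph.fromRel fun x y => ∃ d, G.tail d = x ∧ G.tail (G.inv d) = y

/-- A graph (multiple edges allowed) is 2-connected if it is connected and loopless and stays
connected when any one vertex is removed. -/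
def IsTwoConnected (G : PlaneGraph D) : Prop :=
  G.skeleton.Connected ∧ (∀ d, G.tail (G.inv d) ≠ G.tail d) ∧
    ∀ x : G.Vertex, (G.skeleton.induce {y | y ≠ x}).Connected

/-- An `i`-hedrite: a 2-connected 4-valent plane graph all of whose faces are 2-, 3- or 4-gons,
with `p_2 = 8 - i`. -/
def IsHedrite (G : PlaneGraph D) (i : ℕ) : Prop :=
  G.IsTwoConnected ∧ (∀ x, G.degree x = 4) ∧
    (∀ F, G.gonality F = 2 ∨ G.gonality F = 3 ∨ G.gonality F = 4) ∧ G.numFaces 2 + i = 8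

/-- In a 4-valent plane graph: traverse the dart `d` and continue, at its head, along the edge
opposite to the one of entry. -/
def straight (G : PlaneGraph D) : Equiv.Perm D := G.rot * G.rot * G.inv

/-- A central circuit, given as the set of the darts (in both directions) of all its edges. -/
def IsCentralCircuit (G : PlaneGraph D) (C : Set D) : Prop :=
  ∃ d, C = {e | G.straight.SameCycle d e ∨ G.straight.SameCycle d (G.inv e)}

/-- The 3-gons incident, on the left-hand side, to the central circuit traversed in the
direction of the dart `d`. As `d` runs through the darts of the circuit, both directions of traversal
occur, and so both sides of the circuit. -/
def threeGonsLeftOf (G : PlaneGraph D) (d : D) : Set G.Face :=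
  {F | G.gonality F = 3 ∧ ∃ e, G.straight.SameCycle d e ∧ G.leftFace e = F}

/-- Enter the face to the left of `d` through the edge of `d`, and leave it through the edge two steps
further on its boundary (the opposite edge if the face is a 4-gon) into the next face;
the value is the dart on the edge just crossed that has this next face on its left. -/
def across (G : PlaneGraph D) : Equiv.Perm D := G.inv * G.faceNext * G.faceNext

/-- There is a rail-road: a (possibly self-intersecting) circuit of 4-gons, each of which is adjacent
to its two neighbours in the circuit on opposite edges. -/
def HasRailRoad (G : PlaneGraph D) : Prop :=
  ∃ d, ∀ e, G.across.SameCycle d e → G.gonality (G.leftFace e) = 4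

def IsIrreducible (G : PlaneGraph D) : Prop := ¬ G.HasRailRoad

/-- `G` is the plane graph obtained from the 4-valent plane graph `G'` by deleting its central
circuit `C`: the edges of `C` are removed, the vertices through which `C` passes twice
disappear, and those through which `C` passes once, which are left with degree 2, are smoothed.
In other words, `G'` is obtained from `G` by adding the central circuit `C` (a cutting of `G`).
The map `f` sends a dart of `G` to the initial piece of it in `G'`. -/
structure IsDeletion (G' : PlaneGraph D') (C : Set D') (G : PlaneGraph D) (f : D → D') : Prop where
  injective : Function.Injective f
  /-- the remaining vertices are those through which `C` does not pass -/
  mem_range : ∀ d', d' ∈ Set.range f ↔ d' ∉ C ∧ G'.rot d' ∉ C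
  map_rot : ∀ d, f (G.rot d) = G'.rot (f d)
  /-- an edge of `G` runs straight on in `G'` up to the first remaining vertex -/
  map_inv : ∀ d, ∃ k : ℕ, f (G.inv d) = G'.inv ((G'.straight ^ k) (f d)) ∧
    ∀ j < k, G'.inv ((G'.straight ^ j) (f d)) ∉ Set.range f
  /-- no other central circuit of `G'` loses all its vertices -/
  meets : ∀ d', d' ∉ C → ∃ k : ℕ, (G'.straight ^ k) d' ∈ Set.range f

end PlaneGraph

section

open Function Equiv

/-! The new circuit is found by an extremal choice among families of closed strands drawn over `G`.
A family is recorded by `k : D → ℕ`, with `k d` strands running alongside `d` in its left face, from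
the preceding to the following edge of that face. Strands alongside `d` cross those alongside the
two neighbouring edges near the ends of `d`. Thus every face is cut into 4-gons and one middle face
of the same gonality, whatever `k` is. The pieces fit together as soon as the numbers of crossings
agree on the two sides of each edge (`Balanced`), and then give an 8-hedrite (`Strands.isHedrite`)
from which deleting all the strands recovers `G` (`Strands.isDeletion`).

It remains to choose `k` so that there is a single strand and no rail-road. The trivial families are
those parallel to central circuits (`IsShadow`): such a strand and the circuit beside it bound a
rail-road. Take a family that is not a shadow, with the least total number of crossings. It has no
proper nonzero part: otherwise the part and its complement would be smaller, hence shadows, and so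
would their sum (`exists_isIndecomposable`). The circuit of one strand is a nonzero part, hence
everything (`Strands.isCentralCircuit`). A rail-road in the new graph would also yield a part. If it
runs along an old circuit, the part is a nonzero shadow; if not, it lies strictly between strands
and crosses some edge, and crosses that edge less often than the strands do. Both are impossible
(`Strands.isIrreducible`).

The three 3-gons are needed only for the existence of a weight that is not a shadow. Consecutive
3-gons on one side of a circuit are joined by rows of 4-gons. A connected graph with at least three
vertices has a vertex with two neighbours, so some 3-gon is joined to two other 3-gons through two
of its edges. Start from a constant weight and increase it along one of the two rows. The strand
counts at the two ends of the other row, which lie on the same side of one circuit, now differ. For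
a shadow they would agree (`exists_isWeight_of_faceNext`). -/

/-! ### Cycles of permutations and their lengths -/

theorem Equiv.Perm.SameCycle.mem_of_forall {α : Type*} [Finite α] {p : Perm α} {S : α → Prop}
    (hS : ∀ x, S x → S (p x)) {x y : α} (h : p.SameCycle x y) (hx : S x) : S y := by
  obtain ⟨n, rfl⟩ := h.exists_nat_pow_eq
  induction n with
  | zero => simpa using hx
  | succ n ih => rw [pow_succ', Perm.mul_apply]; exact hS _ (ih ⟨n, by simp⟩)

theorem Equiv.Perm.ncard_sameCycle {α : Type*} [Finite α] (p : Perm α) (x : α) :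
    {y | p.SameCycle x y}.ncard = minimalPeriod p x := by
  have hmem : x ∈ periodicPts p :=
    Function.Injective.mem_periodicPts p.injective x
  have hpos : 0 < minimalPeriod p x := minimalPeriod_pos_of_mem_periodicPts hmem
  have : {y | p.SameCycle x y} = (fun n => p^[n] x) '' (Set.Iio (minimalPeriod p x)) := by
    ext y
    simp only [Set.mem_ofPred_eq, Set.mem_image, Set.mem_Iio]
    constructor
    · intro h
      obtain ⟨n, rfl⟩ := h.exists_nat_pow_eq
      refine ⟨n % minimalPeriod p x, Nat.mod_lt _ hpos, ?_⟩
      rw [iterate_mod_minimalPeriod_eq, Perm.iterate_eq_pow]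
    · rintro ⟨n, -, rfl⟩
      exact ⟨n, by rw [Perm.iterate_eq_pow]; simp⟩
  rw [this, Set.InjOn.ncard_image]
  · rw [← Finset.coe_range, Set.ncard_coe_finset, Finset.card_range]
  · intro a ha b hb hab
    exact (iterate_eq_iterate_iff_of_lt_minimalPeriod ha hb).mp hab

/-- Every proper divisor of 4 divides 2, so excluding the period 2 is enough. -/
theorem Function.minimalPeriod_eq_four_iff {α : Type*} {p : α → α} {x : α} :
    minimalPeriod p x = 4 ↔ p (p (p (p x))) = x ∧ p (p x) ≠ x := by
  constructor
  · intro h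
    refine ⟨?_, ?_⟩
    · have : IsPeriodicPt p 4 x := by rw [isPeriodicPt_iff_minimalPeriod_dvd, h]
      exact this
    · intro h2
      have : IsPeriodicPt p 2 x := h2
      rw [isPeriodicPt_iff_minimalPeriod_dvd, h] at this
      revert this; decide
  · rintro ⟨h4, h2⟩
    have h4 : IsPeriodicPt p 4 x := h4
    have h2 : ¬ IsPeriodicPt p 2 x := h2
    rw [isPeriodicPt_iff_minimalPeriod_dvd] at h4 h2
    have hle := Nat.le_of_dvd (by norm_num) h4
    interval_cases minimalPeriod p x <;> revert h4 h2 <;> decide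

theorem Function.minimalPeriod_eq_three_iff {α : Type*} {p : α → α} {x : α} :
    minimalPeriod p x = 3 ↔ p (p (p x)) = x ∧ p x ≠ x := by
  constructor
  · intro h
    refine ⟨?_, ?_⟩
    · have : IsPeriodicPt p 3 x := by rw [isPeriodicPt_iff_minimalPeriod_dvd, h]
      exact this
    · intro h2
      have : IsPeriodicPt p 1 x := h2
      rw [isPeriodicPt_iff_minimalPeriod_dvd, h] at this
      revert this; decide
  · rintro ⟨h4, h2⟩
    have h4 : IsPeriodicPt p 3 x := h4
    have h2 : ¬ IsPeriodicPt p 1 x := h2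
    rw [isPeriodicPt_iff_minimalPeriod_dvd] at h4 h2
    have hle := Nat.le_of_dvd (by norm_num) h4
    interval_cases minimalPeriod p x <;> revert h4 h2 <;> decide

theorem PermCycles.mk_eq_mk_iff {α : Type*} {p : Perm α} {x y : α} :
    (Quotient.mk _ x : PermCycles p) = Quotient.mk _ y ↔ p.SameCycle x y :=
  Quotient.eq

theorem Function.minimalPeriod_eq_of_injective {α β : Type*} {p : α → α} {q : β → β} {c : α → β}
    (hc : Injective c) (h : ∀ x, q (c x) = c (p x)) (x : α) :
    minimalPeriod q (c x) = minimalPeriod p x := by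
  rw [minimalPeriod_eq_minimalPeriod_iff]
  intro n
  have hs : Semiconj c p q := fun x => (h x).symm
  rw [IsPeriodicPt, IsPeriodicPt, IsFixedPt, IsFixedPt, ← (hs.iterate_right n).eq, hc.eq_iff]

/-- An orbit of `q` that starts in the image of `c` stays there and is the copy of an orbit of `p`.
-/
theorem Equiv.Perm.sameCycle_of_injective {α β : Type*} [Finite β] {p : Perm α} {q : Perm β}
    {c : α → β} (hc : Injective c) (h : ∀ x, q (c x) = c (p x)) {x y : α} :
    q.SameCycle (c x) (c y) ↔ p.SameCycle x y := by
  have hpow : ∀ n : ℕ, (q ^ n) (c x) = c ((p ^ n) x) := by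
    intro n
    induction n with
    | zero => simp
    | succ n ih => rw [pow_succ', Perm.mul_apply, ih, h, pow_succ', Perm.mul_apply]
  have := Finite.of_injective c hc
  constructor
  · intro hxy
    obtain ⟨n, hn⟩ := hxy.exists_nat_pow_eq
    rw [hpow, hc.eq_iff] at hn
    exact ⟨n, by simpa using hn⟩
  · intro hxy
    obtain ⟨n, rfl⟩ := hxy.exists_nat_pow_eq
    exact ⟨n, by simpa using hpow n⟩

namespace PermCycles

variable {α : Type*} [Finite α]

theorem ncard_fiber (p : Perm α) (x : α) :
    {y | (Quotient.mk _ y : PermCycles p) = Quotient.mk _ x}.ncard = minimalPeriod p x := by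
  rw [← Equiv.Perm.ncard_sameCycle]
  congr 1
  ext y
  simp [PermCycles.mk_eq_mk_iff, Perm.sameCycle_comm]

theorem card_eq_sum (p : Perm α) [Fintype (PermCycles p)] :
    Nat.card α = ∑ q : PermCycles p, {y | (Quotient.mk _ y : PermCycles p) = q}.ncard := by
  classical
  have := Fintype.ofFinite α
  rw [Nat.card_eq_fintype_card, ← Finset.card_univ, Finset.card_eq_sum_card_fiberwise
    (f := fun x => (Quotient.mk _ x : PermCycles p)) (t := Finset.univ) (by simp)]
  refine Finset.sum_congr rfl fun q _ => ?_
  rw [← Set.ncard_coe_finset]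
  simp

theorem card_mul (p : Perm α) {c : ℕ} (h : ∀ x, minimalPeriod p x = c) :
    Nat.card α = Nat.card (PermCycles p) * c := by
  have := Fintype.ofFinite (PermCycles p)
  rw [card_eq_sum p, Nat.card_eq_fintype_card, ← Finset.card_univ, Finset.sum_const_nat]
  rintro q -
  induction q using Quotient.inductionOn with
  | h x => rw [ncard_fiber, h]

/-- The curvature form of Euler's formula: for the face permutation of a 4-valent plane graph this
sum is 8, and 4-gons contribute nothing. -/
theorem sum_four_sub (p : Perm α) [Fintype (PermCycles p)] :
    ∑ q : PermCycles p, (4 - ({y | (Quotient.mk _ y : PermCycles p) = q}.ncard : ℤ)) =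
      4 * Nat.card (PermCycles p) - Nat.card α := by
  rw [Finset.sum_sub_distrib, card_eq_sum p, Nat.card_eq_fintype_card]
  simp [mul_comm]

end PermCycles

/-! ### Local structure of 4-valent plane graphs with 3-gons and 4-gons -/

namespace PlaneGraph

variable {D : Type u} (G : PlaneGraph D)

theorem tail_eq_iff {d e : D} : G.tail d = G.tail e ↔ G.rot.SameCycle d e :=
  PermCycles.mk_eq_mk_iff

theorem leftFace_eq_iff {d e : D} : G.leftFace d = G.leftFace e ↔ G.faceNext.SameCycle d e :=
  PermCycles.mk_eq_mk_iff

theorem degree_tail (d : D) : G.degree (G.tail d) = minimalPeriod G.rot d := by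
  have := G.finite
  rw [← Equiv.Perm.ncard_sameCycle, degree]
  congr 1
  ext e
  simp [tail_eq_iff, Perm.sameCycle_comm]

theorem gonality_leftFace (d : D) :
    G.gonality (G.leftFace d) = minimalPeriod G.faceNext d := by
  have := G.finite
  rw [← Equiv.Perm.ncard_sameCycle, gonality]
  congr 1
  ext e
  simp [leftFace_eq_iff, Perm.sameCycle_comm]

@[simp] theorem inv_inv_apply (d : D) : G.inv (G.inv d) = d := G.inv_inv d

@[simp] theorem tail_rot (d : D) : G.tail (G.rot d) = G.tail d := by
  rw [tail_eq_iff, Perm.sameCycle_apply_left]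

/-- The previous dart on the boundary of the face to the left. -/
def facePrev (d : D) : D := G.inv (G.rot d)

theorem faceNext_apply (d : D) : G.faceNext d = G.rot.symm (G.inv d) := rfl

theorem rot_faceNext (d : D) : G.rot (G.faceNext d) = G.inv d := by
  simp [faceNext_apply]

@[simp] theorem faceNext_facePrev (d : D) : G.faceNext (G.facePrev d) = d := by
  simp [faceNext_apply, facePrev]

@[simp] theorem facePrev_faceNext (d : D) : G.facePrev (G.faceNext d) = d := by
  simp [faceNext_apply, facePrev]

@[simp] theorem tail_faceNext (d : D) : G.tail (G.faceNext d) = G.tail (G.inv d) := by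
  rw [← tail_rot, rot_faceNext]

@[simp] theorem leftFace_faceNext (d : D) : G.leftFace (G.faceNext d) = G.leftFace d := by
  rw [leftFace_eq_iff, Perm.sameCycle_apply_left]

@[simp] theorem leftFace_facePrev (d : D) : G.leftFace (G.facePrev d) = G.leftFace d := by
  rw [← leftFace_faceNext, faceNext_facePrev]

theorem straight_apply (d : D) : G.straight d = G.rot (G.rot (G.inv d)) := rfl

theorem across_apply (d : D) : G.across d = G.inv (G.faceNext (G.faceNext d)) := rfl

/-- A plane graph is a quadrangle-triangle graph if it is 4-valent, loopless, and all its faces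
are 3-gons or 4-gons. -/
structure IsTriQuad : Prop where
  rot_four : ∀ d, G.rot (G.rot (G.rot (G.rot d))) = d
  rot_rot_ne : ∀ d, G.rot (G.rot d) ≠ d
  loopless : ∀ d, G.tail (G.inv d) ≠ G.tail d
  face : ∀ d, G.gonality (G.leftFace d) = 3 ∨ G.gonality (G.leftFace d) = 4

variable {G}

theorem IsHedrite.isTriQuad (h : G.IsHedrite 8) : G.IsTriQuad := by
  have := G.finite
  obtain ⟨h2, h4, hf, hn⟩ := h
  have hr : ∀ d, minimalPeriod G.rot d = 4 := fun d => by rw [← degree_tail, h4]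
  refine ⟨fun d => (minimalPeriod_eq_four_iff.mp (hr d)).1,
    fun d => (minimalPeriod_eq_four_iff.mp (hr d)).2, h2.2.1, fun d => ?_⟩
  have h0 : G.numFaces 2 = 0 := by omega
  rw [numFaces, Set.ncard_eq_zero (Set.toFinite _)] at h0
  rcases hf (G.leftFace d) with h | h
  · exact absurd h (Set.eq_empty_iff_forall_notMem.mp h0 (G.leftFace d))
  · exact h

namespace IsTriQuad

theorem faceNext_three {d : D} (hd : G.gonality (G.leftFace d) = 3) :
    G.faceNext (G.faceNext (G.faceNext d)) = d := by
  rw [gonality_leftFace] at hd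
  exact (minimalPeriod_eq_three_iff.mp hd).1

theorem faceNext_four {d : D} (hd : G.gonality (G.leftFace d) = 4) :
    G.faceNext (G.faceNext (G.faceNext (G.faceNext d))) = d := by
  rw [gonality_leftFace] at hd
  exact (minimalPeriod_eq_four_iff.mp hd).1

theorem facePrev_three {d : D} (hd : G.gonality (G.leftFace d) = 3) :
    G.facePrev (G.facePrev d) = G.faceNext d := by
  conv_lhs => rw [← faceNext_three hd]
  simp

theorem facePrev_four {d : D} (hd : G.gonality (G.leftFace d) = 4) :
    G.facePrev (G.facePrev d) = G.faceNext (G.faceNext d) := by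
  conv_lhs => rw [← faceNext_four hd]
  simp

theorem rot_ne (h : G.IsTriQuad) (d : D) : G.rot d ≠ d := fun h1 =>
  h.rot_rot_ne d (by rw [h1, h1])

theorem faceNext_ne (h : G.IsTriQuad) (d : D) : G.faceNext d ≠ d := fun h1 => by
  have h2 := G.tail_faceNext d
  rw [h1] at h2
  exact h.loopless d h2.symm

theorem faceNext_faceNext_ne (h : G.IsTriQuad) (d : D) : G.faceNext (G.faceNext d) ≠ d := fun h1 => by
  rcases h.face d with h3 | h4
  · have := faceNext_three h3
    rw [h1] at this
    exact h.faceNext_ne d this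
  · rw [gonality_leftFace] at h4
    exact (minimalPeriod_eq_four_iff.mp h4).2 h1

theorem faceNext_ne_inv (h : G.IsTriQuad) (d : D) : G.faceNext d ≠ G.inv d := fun h1 => by
  have := G.rot_faceNext d
  rw [h1] at this
  exact h.rot_ne _ this

theorem faceNext_faceNext_ne_inv (h : G.IsTriQuad) (d : D) :
    G.faceNext (G.faceNext d) ≠ G.inv d := fun h1 => by
  have := G.tail_faceNext (G.faceNext d)
  rw [h1, ← tail_faceNext] at this
  exact h.loopless _ this.symm

/-- At a 4-valent vertex two rotations forwards equal two rotations backwards, so going straight can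
be expressed by moves along faces. -/
theorem straight_eq (h : G.IsTriQuad) (d : D) :
    G.straight d = G.faceNext (G.inv (G.faceNext d)) := by
  rw [faceNext_apply, inv_inv_apply, faceNext_apply, Equiv.eq_symm_apply, Equiv.eq_symm_apply]
  rw [straight_apply, h.rot_four]

theorem straight_facePrev (h : G.IsTriQuad) (d : D) :
    G.straight (G.facePrev d) = G.faceNext (G.inv d) := by
  rw [h.straight_eq, faceNext_facePrev]

/-- Stepping across faces carries the sides of a row of 4-gons along central circuits. -/
theorem straight_faceNext (h : G.IsTriQuad) (d : D) :
    G.straight (G.faceNext d) = G.faceNext (G.across d) := by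
  rw [h.straight_eq, across_apply]

/-- Used to show that a rail-road running beside an edge continues beside the central circuit of
that edge. -/
theorem straight_facePrev_inv (h : G.IsTriQuad) (d : D) :
    G.straight (G.facePrev (G.inv (G.facePrev (G.facePrev d)))) = G.facePrev d := by
  rw [h.straight_facePrev, inv_inv_apply, faceNext_facePrev]

end IsTriQuad

end PlaneGraph

/-! ### Drawing strands inside the faces -/

namespace PlaneGraph

variable {D : Type u}

/-- The darts of the graph obtained from a plane graph by adding strands parallel to its edges.
In the left face of `d`, the strands parallel to `d` are the lines `1, 2, …`, and `d` itself is
line `0`. The dart `fwd d j i` is the `i`-th piece of line `j`, directed as `d`, and `bwd d j i` is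
the `i`-th piece of line `j + 1`, in the opposite direction. -/
inductive StrandDart (D : Type u) : Type u
  | fwd (d : D) (j i : ℕ) : StrandDart D
  | bwd (d : D) (j i : ℕ) : StrandDart D

open StrandDart

variable (G : PlaneGraph D) (k : D → ℕ)

/-- The number of strands that cross the edge of `d`, if `k e` strands run parallel to `e` in the
left face of `e`. -/
def width (d : D) : ℕ := k (G.faceNext d) + k (G.facePrev d)

/-- The numbers of strands crossing an edge agree on its two sides. -/
def Balanced : Prop := ∀ d, G.width k (G.inv d) = G.width k d

namespace StrandDart

/-- A line alongside `d` is cut by `width d` others into `width d + 1` pieces. There is no `bwd`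
dart for line `0`, since its reversal is a `fwd` dart of `inv d`. -/
def Valid : StrandDart D → Prop
  | fwd d j i => j ≤ k d ∧ i ≤ G.width k d
  | bwd d j i => j < k d ∧ i ≤ G.width k d

open Classical in
/-- The next dart on the boundary of the face to the left. -/
def face : StrandDart D → StrandDart D
  -- A piece with `i < k (facePrev d)` ends on line `i + 1` of `facePrev d`, and the left turn runs
  -- against that line. Later pieces end on lines of `faceNext d`, which are numbered from the head
  -- of `d`, whence `width - i`. A `bwd` piece ends at its lower-numbered end, on line `i` itself,
  -- whence `≤` in that case.
  | fwd d j i => if i < k (G.facePrev d)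
      then bwd (G.facePrev d) i (G.width k (G.facePrev d) - j)
      else fwd (G.faceNext d) (G.width k d - i) j
  | bwd d j i => if i ≤ k (G.facePrev d)
      then fwd (G.facePrev d) i (G.width k (G.facePrev d) - j)
      else bwd (G.faceNext d) (G.width k d - i) j

/-- The same edge with the opposite direction. -/
def flip : StrandDart D → StrandDart D
  | fwd d 0 i => fwd (G.inv d) 0 (G.width k d - i)
  | fwd d (j + 1) i => bwd d j i
  | bwd d j i => fwd d (j + 1) i

variable {G k}

theorem width_facePrev (d : D) :
    G.width k (G.facePrev d) = k d + k (G.facePrev (G.facePrev d)) := by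
  simp [width]

theorem width_faceNext (d : D) :
    G.width k (G.faceNext d) = k (G.faceNext (G.faceNext d)) + k d := by
  simp [width]

theorem width_eq (d : D) : G.width k d = k (G.faceNext d) + k (G.facePrev d) := rfl

theorem face_fwd_of_lt {d : D} {j i : ℕ} (h : i < k (G.facePrev d)) :
    face G k (fwd d j i) = bwd (G.facePrev d) i (G.width k (G.facePrev d) - j) := if_pos h

theorem face_fwd_of_le {d : D} {j i : ℕ} (h : k (G.facePrev d) ≤ i) :
    face G k (fwd d j i) = fwd (G.faceNext d) (G.width k d - i) j := if_neg h.not_gt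

theorem face_bwd_of_le {d : D} {j i : ℕ} (h : i ≤ k (G.facePrev d)) :
    face G k (bwd d j i) = fwd (G.facePrev d) i (G.width k (G.facePrev d) - j) := if_pos h

theorem face_bwd_of_lt {d : D} {j i : ℕ} (h : k (G.facePrev d) < i) :
    face G k (bwd d j i) = bwd (G.faceNext d) (G.width k d - i) j := if_neg h.not_ge

theorem Valid.face {x : StrandDart D} (hx : Valid G k x) : Valid G k (face G k x) := by
  cases x with
  | fwd d j i =>
    obtain ⟨h1, h2⟩ := hx
    have := width_eq (G := G) (k := k) d
    have := width_facePrev (G := G) (k := k) d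
    have := width_faceNext (G := G) (k := k) d
    rcases lt_or_ge i (k (G.facePrev d)) with h | h
    · rw [face_fwd_of_lt h]; constructor <;> omega
    · rw [face_fwd_of_le h]; constructor <;> omega
  | bwd d j i =>
    obtain ⟨h1, h2⟩ := hx
    have := width_eq (G := G) (k := k) d
    have := width_facePrev (G := G) (k := k) d
    have := width_faceNext (G := G) (k := k) d
    rcases le_or_gt i (k (G.facePrev d)) with h | h
    · rw [face_bwd_of_le h]; constructor <;> omega
    · rw [face_bwd_of_lt h]; constructor <;> omega

theorem Valid.flip (hk : G.Balanced k) {x : StrandDart D} (hx : Valid G k x) :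
    Valid G k (flip G k x) := by
  match x, hx with
  | fwd d 0 i, ⟨h1, h2⟩ => exact ⟨Nat.zero_le _, by rw [hk]; omega⟩
  | fwd d (j + 1) i, ⟨h1, h2⟩ => exact ⟨h1, h2⟩
  | bwd d j i, ⟨h1, h2⟩ => exact ⟨h1, h2⟩

theorem flip_flip (hk : G.Balanced k) {x : StrandDart D} (hx : Valid G k x) :
    flip G k (flip G k x) = x := by
  match x, hx with
  | fwd d 0 i, ⟨h1, h2⟩ =>
    simp only [StrandDart.flip, inv_inv_apply, hk d]
    congr 1; omega
  | fwd d (j + 1) i, ⟨h1, h2⟩ => rfl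
  | bwd d j i, ⟨h1, h2⟩ => rfl

theorem flip_ne (x : StrandDart D) : flip G k x ≠ x := by
  match x with
  | fwd d 0 i => simp [StrandDart.flip, G.inv_ne]
  | fwd d (j + 1) i => simp [StrandDart.flip]
  | bwd d j i => simp [StrandDart.flip]

/-- The next dart, clockwise, with the same tail. -/
def cw (x : StrandDart D) : StrandDart D := face G k (flip G k x)

section corner

variable {d : D} {j i : ℕ}

/-- The four darts at the crossing of line `j + 1` parallel to `d` with line `i + 1` parallel to
the previous dart. -/
theorem cw_inner_one (hi : i < k (G.facePrev d)) :
    cw (G := G) (k := k) (fwd d (j + 1) (i + 1)) =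
      fwd (G.facePrev d) (i + 1) (G.width k (G.facePrev d) - j) :=
  face_bwd_of_le hi

theorem cw_inner_two (hj : j < k d) :
    cw (G := G) (k := k) (fwd (G.facePrev d) (i + 1) (G.width k (G.facePrev d) - j)) =
      bwd d j i := by
  have := width_facePrev (G := G) (k := k) d
  have := face_bwd_of_lt (G := G) (k := k) (d := G.facePrev d) (j := i)
    (i := G.width k (G.facePrev d) - j) (by omega)
  rw [faceNext_facePrev] at this
  refine this.trans ?_
  congr 1; omega

theorem cw_inner_three (hi : i < k (G.facePrev d)) :
    cw (G := G) (k := k) (bwd d j i) =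
      bwd (G.facePrev d) i (G.width k (G.facePrev d) - (j + 1)) :=
  face_fwd_of_lt hi

theorem cw_inner_four (hj : j < k d) :
    cw (G := G) (k := k) (bwd (G.facePrev d) i (G.width k (G.facePrev d) - (j + 1))) =
      fwd d (j + 1) (i + 1) := by
  have := width_facePrev (G := G) (k := k) d
  have := face_fwd_of_le (G := G) (k := k) (d := G.facePrev d) (j := i + 1)
    (i := G.width k (G.facePrev d) - (j + 1)) (by omega)
  rw [faceNext_facePrev] at this
  refine this.trans ?_
  congr 1; omega

/-- The strand dart that crosses the edge of `d` into its left face, as strand number `i + 1` from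
the tail. -/
def enter (G : PlaneGraph D) (k : D → ℕ) (d : D) (i : ℕ) : StrandDart D := face G k (fwd d 0 i)

theorem enter_of_lt (h : i < k (G.facePrev d)) :
    enter G k d i = bwd (G.facePrev d) i (G.width k (G.facePrev d)) := face_fwd_of_lt h

theorem enter_of_le (h : k (G.facePrev d) ≤ i) :
    enter G k d i = fwd (G.faceNext d) (G.width k d - i) 0 := face_fwd_of_le h

/-- The four darts at the crossing of the edge of `d` with a strand. -/
theorem cw_edge :
    cw (G := G) (k := k) (fwd d 0 i) = enter G k (G.inv d) (G.width k d - i) := rfl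

theorem cw_enter (hi : i < G.width k d) :
    cw (G := G) (k := k) (enter G k d i) = fwd d 0 (i + 1) := by
  have h1 := width_eq (G := G) (k := k) d
  have h2 := width_facePrev (G := G) (k := k) d
  have h3 := width_faceNext (G := G) (k := k) d
  rcases lt_or_ge i (k (G.facePrev d)) with h | h
  · rw [enter_of_lt h]
    have := face_fwd_of_le (G := G) (k := k) (d := G.facePrev d) (j := i + 1)
      (i := G.width k (G.facePrev d)) (by omega)
    rw [faceNext_facePrev] at this
    refine this.trans ?_
    congr 1; omega
  · rw [enter_of_le h]
    obtain ⟨j, hj⟩ : ∃ j, G.width k d - i = j + 1 := ⟨G.width k d - i - 1, by omega⟩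
    rw [hj]
    have := face_bwd_of_le (G := G) (k := k) (d := G.faceNext d) (j := j) (i := 0) (by omega)
    rw [facePrev_faceNext] at this
    refine this.trans ?_
    congr 1; omega

theorem cw_vertex (hk : G.Balanced k) :
    cw (G := G) (k := k) (fwd d 0 0) = fwd (G.rot.symm d) 0 0 := by
  have h3 := width_eq (G := G) (k := k) (G.inv d)
  have := hk d
  have := face_fwd_of_le (G := G) (k := k) (d := G.inv d) (j := 0)
      (i := G.width k d) (by omega)
  rw [faceNext_apply, inv_inv_apply] at this
  refine this.trans ?_
  congr 1; omega

end corner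

theorem enter_valid {d : D} {i : ℕ} (hi : i ≤ G.width k d) : Valid G k (enter G k d i) :=
  Valid.face (x := fwd d 0 i) ⟨Nat.zero_le _, hi⟩

/-- A case distinction for the vertices: original vertices, crossings of an edge with a strand,
crossings of two strands. -/
theorem Valid.vertex_cases (hk : G.Balanced k) {P : StrandDart D → Prop}
    (hcw : ∀ x, Valid G k x → P x → P (cw (G := G) (k := k) x))
    (vertex : ∀ d, P (fwd d 0 0))
    (edge : ∀ d i, i < G.width k d → P (fwd d 0 (i + 1)))
    (inner : ∀ d j i, j < k d → i < k (G.facePrev d) → P (fwd d (j + 1) (i + 1)))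
    {x : StrandDart D} (hx : Valid G k x) : P x := by
  have henter : ∀ d i, i < G.width k d → P (enter G k d i) := by
    intro d i hi
    obtain ⟨l, hl⟩ : ∃ l, l + 1 + i = G.width k d := ⟨G.width k d - i - 1, by omega⟩
    have := cw_edge (G := G) (k := k) (d := G.inv d) (i := l + 1)
    rw [inv_inv_apply, hk, show G.width k d - (l + 1) = i by omega] at this
    rw [← this]
    exact hcw _ ⟨Nat.zero_le _, by rw [hk]; omega⟩ (edge _ _ (by rw [hk]; omega))
  have hbwd : ∀ d j i, j < k d → i < k (G.facePrev d) → P (bwd d j i) := by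
    intro d j i hj hi
    have h1 := width_eq (G := G) (k := k) d
    have h2 := width_facePrev (G := G) (k := k) d
    rw [← cw_inner_two hj, ← cw_inner_one hi]
    refine hcw _ ?_ (hcw _ ⟨hj, ?_⟩ (inner _ _ _ hj hi))
    · rw [cw_inner_one hi]; exact ⟨hi, by omega⟩
    · omega
  match x, hx with
  | fwd d 0 0, _ => exact vertex d
  | fwd d 0 (i + 1), ⟨_, h⟩ => exact edge d i h
  | fwd d (j + 1) 0, ⟨hj, hi⟩ =>
    have h2 := width_facePrev (G := G) (k := k) d
    have := enter_of_le (G := G) (k := k) (d := G.facePrev d)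
      (i := G.width k (G.facePrev d) - (j + 1)) (by omega)
    rw [faceNext_facePrev,
      show G.width k (G.facePrev d) - (G.width k (G.facePrev d) - (j + 1)) = j + 1 by omega] at this
    rw [← this]
    exact henter _ _ (by omega)
  | fwd d (j + 1) (i + 1), ⟨hj, hi⟩ =>
    have h1 := width_eq (G := G) (k := k) d
    have h3 := width_faceNext (G := G) (k := k) d
    rcases lt_or_ge i (k (G.facePrev d)) with h | h
    · exact inner _ _ _ hj h
    -- This crossing is near the head of `d`; it is treated as a crossing at the corner of `faceNext
    -- d`.
    · obtain ⟨l, hl⟩ : ∃ l, l + (i + 1) = G.width k d := ⟨G.width k d - (i + 1), by omega⟩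
      have := cw_inner_one (G := G) (k := k) (d := G.faceNext d) (j := l) (i := j)
        (by rwa [facePrev_faceNext])
      rw [facePrev_faceNext, show G.width k d - l = i + 1 by omega] at this
      rw [← this]
      exact hcw _ ⟨by omega, by omega⟩ (inner _ _ _ (by omega) (by rwa [facePrev_faceNext]))
  | bwd d j i, ⟨hj, hi⟩ =>
    have h1 := width_eq (G := G) (k := k) d
    have h3 := width_faceNext (G := G) (k := k) d
    rcases lt_or_ge i (k (G.facePrev d)) with h | h
    · exact hbwd _ _ _ hj h
    · rcases Nat.eq_or_lt_of_le hi with h4 | h4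
      · have := henter (G.faceNext d) j (by omega)
        rwa [enter_of_lt (by rwa [facePrev_faceNext]), facePrev_faceNext, ← h4] at this
      · obtain ⟨l, hl⟩ : ∃ l, l + 1 + i = G.width k d := ⟨G.width k d - i - 1, by omega⟩
        have := cw_inner_three (G := G) (k := k) (d := G.faceNext d) (j := l) (i := j)
          (by rwa [facePrev_faceNext])
        rw [facePrev_faceNext, show G.width k d - (l + 1) = i by omega] at this
        rw [← this]
        exact hcw _ ⟨by omega, by omega⟩ (hbwd _ _ _ (by omega) (by rwa [facePrev_faceNext]))

theorem Valid.cw (hk : G.Balanced k) {x : StrandDart D} (hx : Valid G k x) :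
    Valid G k (cw (G := G) (k := k) x) := (hx.flip hk).face

theorem cw_cw_edge (hk : G.Balanced k) {d : D} {i : ℕ} (hi : i < G.width k d) :
    cw (G := G) (k := k) (cw (G := G) (k := k) (fwd d 0 (i + 1))) =
      fwd (G.inv d) 0 (G.width k d - i) := by
  rw [cw_edge, cw_enter (by rw [hk]; omega)]
  congr 1; omega

theorem cw_cw_inner {d : D} {j i : ℕ} (hj : j < k d) (hi : i < k (G.facePrev d)) :
    cw (G := G) (k := k) (cw (G := G) (k := k) (fwd d (j + 1) (i + 1))) = bwd d j i := by
  rw [cw_inner_one hi, cw_inner_two hj]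

/-- The claim is invariant under rotation, so one dart per vertex suffices. At a crossing, two
rotations lead to the opposite dart on the same line; at an old vertex the rotation is that of `G`.
-/
theorem cw_four (h : G.IsTriQuad) (hk : G.Balanced k) {x : StrandDart D} (hx : Valid G k x) :
    cw (G := G) (k := k) (cw (G := G) (k := k) (cw (G := G) (k := k) (cw (G := G) (k := k) x))) = x
    ∧ cw (G := G) (k := k) (cw (G := G) (k := k) x) ≠ x := by
  refine Valid.vertex_cases (P := fun x => cw (G := G) (k := k) (cw (G := G) (k := k)
    (cw (G := G) (k := k) (cw (G := G) (k := k) x))) = x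
    ∧ cw (G := G) (k := k) (cw (G := G) (k := k) x) ≠ x) hk ?_ ?_ ?_ ?_ hx
  · rintro x - ⟨h4, h2⟩
    refine ⟨by rw [h4], fun h3 => h2 ?_⟩
    have := congrArg (cw (G := G) (k := k)) (congrArg (cw (G := G) (k := k)) h3)
    rw [← h3, h4] at this
    rw [h3] at h4
    exact h3.symm ▸ (this.symm ▸ h4 : _)
  · intro d
    simp only [cw_vertex hk]
    constructor
    · congr 1
      simp only [Equiv.symm_apply_eq]
      rw [h.rot_four]
    · intro h1
      injection h1 with h1
      rw [Equiv.symm_apply_eq, Equiv.symm_apply_eq] at h1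
      exact h.rot_rot_ne d h1.symm
  · intro d i hi
    rw [cw_cw_edge hk hi]
    obtain ⟨l, hl⟩ : ∃ l, G.width k d - i = l + 1 ∧ l + 1 + i = G.width k d :=
      ⟨G.width k d - i - 1, by omega, by omega⟩
    constructor
    · rw [hl.1, cw_cw_edge hk (by rw [hk]; omega), inv_inv_apply, hk]
      congr 1; omega
    · simp [G.inv_ne]
  · intro d j i hj hi
    rw [cw_cw_inner hj hi, cw_inner_three hi, cw_inner_four hj]
    simp
end StrandDart

end PlaneGraph

/-! ### The faces of the new graph and Euler's formula -/

namespace PlaneGraph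

variable {D : Type u} {G : PlaneGraph D} {k : D → ℕ}

namespace StrandDart

/-- The dart on the boundary of the middle part of the left face of `d`. -/
def center (G : PlaneGraph D) (k : D → ℕ) (d : D) : StrandDart D := fwd d (k d) (k (G.facePrev d))

theorem center_valid (d : D) : Valid G k (center G k d) :=
  ⟨le_rfl, by rw [width_eq]; omega⟩

theorem face_center (d : D) : face G k (center G k d) = center G k (G.faceNext d) := by
  rw [center, face_fwd_of_le le_rfl, center, facePrev_faceNext, width_eq]
  congr 1; omega

theorem center_injective : Injective (center G k) := by
  intro d e hde
  injection hde

/-- Between two adjacent parallel lines, the side opposite to a piece is the piece with the same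
number on the next line. -/
theorem face_face_fwd_of_lt {d : D} {j i : ℕ} (hj : j < k d) (hi : i ≤ G.width k d) :
    face G k (face G k (fwd d j i)) = bwd d j i := by
  have h2 := width_facePrev (G := G) (k := k) d
  rcases lt_or_ge i (k (G.facePrev d)) with h | h
  · rw [face_fwd_of_lt h, face_bwd_of_lt (by omega), faceNext_facePrev]
    congr 1; omega
  · rw [face_fwd_of_le h, face_fwd_of_lt (by rwa [facePrev_faceNext]), facePrev_faceNext]
    congr 1; omega

theorem face_face_bwd {d : D} {j i : ℕ} (hj : j < k d) (hi : i ≤ G.width k d) :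
    face G k (face G k (bwd d j i)) = fwd d j i := by
  have h2 := width_facePrev (G := G) (k := k) d
  rcases le_or_gt i (k (G.facePrev d)) with h | h
  · rw [face_bwd_of_le h, face_fwd_of_le (by omega), faceNext_facePrev]
    congr 1; omega
  · rw [face_bwd_of_lt h, face_bwd_of_le (by rw [facePrev_faceNext]; omega), facePrev_faceNext]
    congr 1; omega

/-- Beyond the innermost line of `d`, the strip between lines `i` and `i + 1` of `facePrev d`
reaches the innermost line of the edge before `facePrev d`. -/
theorem face_face_last_of_lt {d : D} {i : ℕ} (hi : i < k (G.facePrev d)) :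
    face G k (face G k (fwd d (k d) i)) =
      fwd (G.facePrev (G.facePrev d)) (k (G.facePrev (G.facePrev d)))
        (G.width k (G.facePrev (G.facePrev d)) - i) := by
  have h2 := width_facePrev (G := G) (k := k) d
  rw [face_fwd_of_lt hi, face_bwd_of_le (by omega)]
  congr 1; omega

theorem face_face_last_of_le {d : D} {i : ℕ} (hi : k (G.facePrev d) ≤ i) :
    face G k (face G k (fwd d (k d) i)) =
      fwd (G.faceNext (G.faceNext d)) (k (G.faceNext (G.faceNext d))) (G.width k d - i) := by
  have h2 := width_faceNext (G := G) (k := k) d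
  rw [face_fwd_of_le hi, face_fwd_of_le (by rw [facePrev_faceNext])]
  congr 1; omega

/-- Every face is either the middle part of an original face or a 4-gon. -/
theorem Valid.eq_center_or (h : G.IsTriQuad) {x : StrandDart D} (hx : Valid G k x) :
    (∃ d, x = center G k d) ∨
      StrandDart.face G k (StrandDart.face G k (StrandDart.face G k (StrandDart.face G k x))) = x ∧
        StrandDart.face G k (StrandDart.face G k x) ≠ x := by
  match x, hx with
  | bwd d j i, ⟨hj, hi⟩ =>
    right
    rw [face_face_bwd hj hi, face_face_fwd_of_lt hj hi]
    simp
  | fwd d j i, ⟨hj, hi⟩ =>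
    rcases Nat.eq_or_lt_of_le hj with rfl | hj
    · rw [width_eq] at hi
      rcases lt_trichotomy i (k (G.facePrev d)) with hlt | rfl | hlt
      · right
        have h3 := width_faceNext (G := G) (k := k) (G.facePrev (G.facePrev d))
        have h4 := width_eq (G := G) (k := k) (G.facePrev (G.facePrev d))
        rw [faceNext_facePrev] at h4
        rw [face_face_last_of_lt hlt, face_face_last_of_le (by omega)]
        simp only [faceNext_facePrev]
        refine ⟨?_, ?_⟩
        · congr 1; omega
        · intro h1
          injection h1 with h1
          have := congrArg (fun e => G.faceNext (G.faceNext e)) h1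
          simp only [faceNext_facePrev] at this
          exact h.faceNext_faceNext_ne d this.symm
      · left; exact ⟨d, rfl⟩
      · right
        have h4 := width_eq (G := G) (k := k) d
        rw [face_face_last_of_le hlt.le, face_face_last_of_lt (by rw [facePrev_faceNext]; omega)]
        simp only [facePrev_faceNext]
        refine ⟨?_, ?_⟩
        · congr 1; omega
        · intro h1
          injection h1 with h1
          exact h.faceNext_faceNext_ne d h1
    · right
      rw [face_face_fwd_of_lt hj hi, face_face_bwd hj hi]
      simp

end StrandDart

open StrandDart

variable (G k) in
/-- The darts of the graph with the strands added. -/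
abbrev StrandDarts : Type u := {x : StrandDart D // Valid G k x}

theorem finite_strandDarts : Finite (StrandDarts G k) := by
  have := G.finite
  obtain ⟨K, hK⟩ : ∃ K, ∀ d, k d ≤ K := (Set.finite_range k).bddAbove.imp
    fun K hK d => hK ⟨d, rfl⟩
  have hv : ∀ x : StrandDart D, Valid G k x → ∃ (d : D) (j i : Fin (2 * K + 1)),
      x = fwd d j i ∨ x = bwd d j i := by
    intro x hx
    cases x with
    | fwd d j i =>
      obtain ⟨h1, h2⟩ := hx
      rw [width_eq] at h2
      have := hK d; have := hK (G.faceNext d); have := hK (G.facePrev d)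
      exact ⟨d, ⟨j, by omega⟩, ⟨i, by omega⟩, Or.inl rfl⟩
    | bwd d j i =>
      obtain ⟨h1, h2⟩ := hx
      rw [width_eq] at h2
      have := hK d; have := hK (G.faceNext d); have := hK (G.facePrev d)
      exact ⟨d, ⟨j, by omega⟩, ⟨i, by omega⟩, Or.inr rfl⟩
  let g : D × Fin (2 * K + 1) × Fin (2 * K + 1) × Bool → StrandDart D :=
    fun p => if p.2.2.2 then fwd p.1 p.2.1 p.2.2.1 else bwd p.1 p.2.1 p.2.2.1
  have hg : {x | Valid G k x} ⊆ Set.range g := by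
    intro x hx
    obtain ⟨d, j, i, rfl | rfl⟩ := hv x hx
    · exact ⟨(d, j, i, true), rfl⟩
    · exact ⟨(d, j, i, false), rfl⟩
  exact ((Set.finite_range g).subset hg).to_subtype

/-- The data of an addition of strands: `k d` strands run parallel to `d` in its left face. -/
structure Strands (G : PlaneGraph D) (k : D → ℕ) : Prop where
  triQuad : G.IsTriQuad
  balanced : G.Balanced k

namespace Strands

variable (s : G.Strands k)

def inv : Perm (StrandDarts G k) where
  toFun x := ⟨flip G k x, x.2.flip s.balanced⟩
  invFun x := ⟨flip G k x, x.2.flip s.balanced⟩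
  left_inv x := Subtype.ext (flip_flip s.balanced x.2)
  right_inv x := Subtype.ext (flip_flip s.balanced x.2)

def cwPerm : Perm (StrandDarts G k) where
  toFun x := ⟨cw (G := G) (k := k) x, x.2.cw s.balanced⟩
  invFun x := ⟨cw (G := G) (k := k) (cw (G := G) (k := k) (cw (G := G) (k := k) x)),
    ((x.2.cw s.balanced).cw s.balanced).cw s.balanced⟩
  left_inv x := Subtype.ext (cw_four s.triQuad s.balanced x.2).1
  right_inv x := Subtype.ext (cw_four s.triQuad s.balanced x.2).1

def rot : Perm (StrandDarts G k) := s.cwPerm⁻¹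

@[simp] theorem coe_inv (x : StrandDarts G k) : (s.inv x : StrandDart D) = flip G k x := rfl

@[simp] theorem coe_rot_symm (x : StrandDarts G k) :
    (s.rot.symm x : StrandDart D) = cw (G := G) (k := k) x := rfl

def face : Perm (StrandDarts G k) := s.rot⁻¹ * s.inv

@[simp] theorem coe_face (x : StrandDarts G k) :
    (s.face x : StrandDart D) = StrandDart.face G k x := by
  change StrandDart.face G k (flip G k (flip G k x)) = _
  rw [flip_flip s.balanced x.2]

theorem rot_four (x : StrandDarts G k) : s.rot (s.rot (s.rot (s.rot x))) = x := by
  simp only [← Equiv.eq_symm_apply]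
  exact Subtype.ext (cw_four s.triQuad s.balanced x.2).1.symm

theorem rot_rot_ne (x : StrandDarts G k) : s.rot (s.rot x) ≠ x := by
  intro h1
  simp only [← Equiv.eq_symm_apply] at h1
  exact (cw_four s.triQuad s.balanced x.2).2 (congrArg Subtype.val h1).symm

end Strands

namespace IsTriQuad

theorem minimalPeriod_rot (h : G.IsTriQuad) (d : D) : minimalPeriod G.rot d = 4 :=
  minimalPeriod_eq_four_iff.mpr ⟨h.rot_four d, h.rot_rot_ne d⟩

end IsTriQuad

theorem minimalPeriod_inv {α : Type*} {p : Perm α} (h : ∀ x, p (p x) = x) (h' : ∀ x, p x ≠ x) (x : α) :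
    minimalPeriod p x = 2 := by
  have h2 : IsPeriodicPt p 2 x := h x
  rw [isPeriodicPt_iff_minimalPeriod_dvd] at h2
  have h1 : ¬ IsPeriodicPt p 1 x := h' x
  rw [isPeriodicPt_iff_minimalPeriod_dvd] at h1
  have hle := Nat.le_of_dvd (by norm_num) h2
  interval_cases minimalPeriod p x <;> revert h1 h2 <;> decide

namespace StrandDart

theorem cw_face_fwd {d : D} {j i : ℕ} (hj : j ≤ k d) (hi : i < G.width k d) :
    cw (G := G) (k := k) (face G k (fwd d j i)) = fwd d j (i + 1) := by
  cases j with
  | zero => exact cw_enter hi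
  | succ j =>
    rcases lt_or_ge i (k (G.facePrev d)) with h | h
    · rw [face_fwd_of_lt h, cw_inner_four (by omega)]
    · have h1 := width_eq (G := G) (k := k) d
      obtain ⟨l, hl⟩ : ∃ l, i + (l + 1) = G.width k d := ⟨G.width k d - i - 1, by omega⟩
      rw [face_fwd_of_le h, show G.width k d - i = l + 1 by omega,
        cw_inner_one (by rw [facePrev_faceNext]; omega), facePrev_faceNext]
      congr 1; omega

theorem cw_face_last {d : D} {j : ℕ} :
    cw (G := G) (k := k) (face G k (fwd d j (G.width k d))) =
      cw (G := G) (k := k) (fwd (G.faceNext d) 0 j) := by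
  rw [face_fwd_of_le (by rw [width_eq]; omega), Nat.sub_self]

end StrandDart

namespace Strands

variable (s : G.Strands k)

theorem rot_rot (x : StrandDarts G k) : s.rot (s.rot x) = s.rot.symm (s.rot.symm x) := by
  rw [Equiv.eq_symm_apply, Equiv.eq_symm_apply, s.rot_four]

def straight : Perm (StrandDarts G k) := s.rot * s.rot * s.inv

theorem coe_straight (x : StrandDarts G k) :
    (s.straight x : StrandDart D) = cw (G := G) (k := k) (StrandDart.face G k x) := by
  change (s.rot (s.rot (s.inv x)) : StrandDart D) = _
  rw [rot_rot, ← coe_face]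
  rfl

theorem straight_fwd {d : D} {j i : ℕ} (hj : j ≤ k d) (hi : i < G.width k d) :
    s.straight ⟨fwd d j i, hj, hi.le⟩ = ⟨fwd d j (i + 1), hj, hi⟩ :=
  Subtype.ext (by rw [coe_straight]; exact cw_face_fwd hj hi)

/-- The first piece of an original dart. -/
def base (G : PlaneGraph D) (k : D → ℕ) (d : D) : StrandDarts G k :=
  ⟨fwd d 0 0, Nat.zero_le _, Nat.zero_le _⟩

@[simp] theorem coe_base (d : D) : (base G k d : StrandDart D) = fwd d 0 0 := rfl

theorem straight_last (d : D) :
    s.straight ⟨fwd d 0 (G.width k d), Nat.zero_le _, le_rfl⟩ = base G k (G.straight d) := by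
  refine Subtype.ext ?_
  rw [coe_straight]
  refine cw_face_last.trans ?_
  rw [cw_vertex s.balanced, s.triQuad.straight_eq, coe_base, G.faceNext_apply (G.inv _), inv_inv_apply]

theorem straight_pow {d : D} {j : ℕ} (hj : j ≤ k d) (i : ℕ) (hi : i ≤ G.width k d) :
    (s.straight ^ i) ⟨fwd d j 0, hj, Nat.zero_le _⟩ = ⟨fwd d j i, hj, hi⟩ := by
  induction i with
  | zero => rfl
  | succ i ih => rw [pow_succ', Perm.mul_apply, ih (by omega), s.straight_fwd hj hi]

theorem rot_base (d : D) : s.rot (base G k d) = base G k (G.rot d) := by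
  rw [← Equiv.eq_symm_apply]
  refine Subtype.ext ?_
  rw [coe_rot_symm, coe_base, coe_base, cw_vertex s.balanced, Equiv.symm_apply_apply]

theorem inv_last (d : D) :
    s.inv ⟨fwd d 0 (G.width k d), Nat.zero_le _, le_rfl⟩ = base G k (G.inv d) :=
  Subtype.ext (by simp [StrandDart.flip])

def across : Perm (StrandDarts G k) := s.inv * s.face * s.face

theorem coe_across (x : StrandDarts G k) :
    (s.across x : StrandDart D) = flip G k (StrandDart.face G k (StrandDart.face G k x)) := by
  change (s.inv (s.face (s.face x)) : StrandDart D) = _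
  simp

theorem across_fwd {d : D} {j i : ℕ} (hj : j < k d) (hi : i ≤ G.width k d) :
    s.across ⟨fwd d j i, hj.le, hi⟩ = ⟨fwd d (j + 1) i, hj, hi⟩ :=
  Subtype.ext (by rw [coe_across]; exact congrArg (flip G k) (face_face_fwd_of_lt hj hi))

/-- Two darts are linked if a product of rotations and inversions maps one to the other. -/
def Linked (x y : StrandDarts G k) : Prop := ∃ g ∈ Subgroup.closure {s.rot, s.inv}, g x = y

variable {s}

theorem Linked.refl (x : StrandDarts G k) : s.Linked x x := ⟨1, one_mem _, rfl⟩

theorem Linked.symm {x y : StrandDarts G k} : s.Linked x y → s.Linked y x := by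
  rintro ⟨g, hg, rfl⟩
  exact ⟨g⁻¹, inv_mem hg, by simp⟩

theorem Linked.trans {x y z : StrandDarts G k} : s.Linked x y → s.Linked y z → s.Linked x z := by
  rintro ⟨g, hg, rfl⟩ ⟨g', hg', rfl⟩
  exact ⟨g' * g, mul_mem hg' hg, rfl⟩

variable (s)

theorem rot_mem : s.rot ∈ Subgroup.closure {s.rot, s.inv} := Subgroup.subset_closure (by simp)

theorem inv_mem : s.inv ∈ Subgroup.closure {s.rot, s.inv} := Subgroup.subset_closure (by simp)

theorem straight_mem : s.straight ∈ Subgroup.closure {s.rot, s.inv} :=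
  mul_mem (mul_mem s.rot_mem s.rot_mem) s.inv_mem

theorem face_mem : s.face ∈ Subgroup.closure {s.rot, s.inv} :=
  mul_mem (InvMemClass.inv_mem s.rot_mem) s.inv_mem

theorem across_mem : s.across ∈ Subgroup.closure {s.rot, s.inv} :=
  mul_mem (mul_mem s.inv_mem s.face_mem) s.face_mem

/-- `straight` moves along a line and `across` moves to the next parallel line, so the first piece
of the edge reaches everything alongside it. -/
theorem linked_base (x : StrandDarts G k) : ∃ d, s.Linked (base G k d) x := by
  have key : ∀ (d : D) (j i : ℕ) (hj : j ≤ k d) (hi : i ≤ G.width k d),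
      s.Linked (base G k d) ⟨fwd d j i, hj, hi⟩ := by
    intro d j i hj hi
    induction j with
    | zero => exact ⟨s.straight ^ i, pow_mem s.straight_mem i, s.straight_pow hj i hi⟩
    | succ j ih => exact (ih (by omega)).trans ⟨s.across, s.across_mem, s.across_fwd hj hi⟩
  match x with
  | ⟨fwd d j i, hj, hi⟩ => exact ⟨d, key d j i hj hi⟩
  | ⟨bwd d j i, hj, hi⟩ =>
    exact ⟨d, (key d (j + 1) i hj hi).trans ⟨s.inv, s.inv_mem, rfl⟩⟩

theorem linked_base_base (d e : D) : s.Linked (base G k d) (base G k e) := by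
  obtain ⟨g, hg, rfl⟩ := G.connected d e
  revert d
  induction hg using Subgroup.closure_induction with
  | mem g hg =>
    intro d
    rcases hg with rfl | rfl
    · exact ⟨s.rot, s.rot_mem, s.rot_base d⟩
    · refine Linked.trans ⟨s.straight ^ G.width k d, pow_mem s.straight_mem _,
        s.straight_pow (Nat.zero_le _) _ le_rfl⟩ ⟨s.inv, s.inv_mem, s.inv_last d⟩
  | one => exact fun d => Linked.refl _
  | mul g g' _ _ h h' => exact fun d => (h' d).trans (h _)
  | inv g _ h => exact fun d => by simpa using (h (g⁻¹ d)).symm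

theorem linked (x y : StrandDarts G k) : s.Linked x y := by
  obtain ⟨d, hd⟩ := s.linked_base x
  obtain ⟨e, he⟩ := s.linked_base y
  exact hd.symm.trans ((s.linked_base_base d e).trans he)

/-- With all degrees equal to 4, Euler's formula says that `4 - gonality` has sum 8 over the faces.
The middle faces are copies of the old faces, and every other face is a 4-gon and contributes 0, so
the sum is that of `G`. -/
theorem euler : Nat.card (PermCycles s.rot) + Nat.card (PermCycles (s.rot⁻¹ * s.inv)) =
    Nat.card (PermCycles s.inv) + 2 := by
  have := G.finite
  have := finite_strandDarts (G := G) (k := k)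
  have := Fintype.ofFinite (PermCycles s.face)
  have := Fintype.ofFinite (PermCycles G.faceNext)
  have e1 := PermCycles.card_mul G.rot s.triQuad.minimalPeriod_rot
  have e2 := PermCycles.card_mul G.inv (minimalPeriod_inv G.inv_inv G.inv_ne)
  have e3 := PermCycles.card_mul s.rot
    (fun x => minimalPeriod_eq_four_iff.mpr ⟨s.rot_four x, s.rot_rot_ne x⟩)
  have e4 := PermCycles.card_mul s.inv (minimalPeriod_inv
    (fun x => Subtype.ext (flip_flip s.balanced x.2))
    (fun x h1 => flip_ne x.1 (congrArg Subtype.val h1)))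
  have e5 := PermCycles.sum_four_sub s.face
  have e6 := PermCycles.sum_four_sub G.faceNext
  let c : D → StrandDarts G k := fun d => ⟨center G k d, center_valid d⟩
  have hc : Injective c := fun d e h => center_injective (congrArg Subtype.val h)
  have hcf : ∀ d, s.face (c d) = c (G.faceNext d) := fun d => Subtype.ext (by
    rw [coe_face]; exact face_center d)
  let Φ : PermCycles G.faceNext → PermCycles s.face := Quotient.map c
    fun d e h => (Perm.sameCycle_of_injective hc hcf).mpr h
  have hΦ : Injective Φ := by
    intro q q'
    induction q using Quotient.inductionOn with | h d =>
    induction q' using Quotient.inductionOn with | h e =>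
    intro h
    exact PermCycles.mk_eq_mk_iff.mpr
      ((Perm.sameCycle_of_injective hc hcf).mp (PermCycles.mk_eq_mk_iff.mp h))
  have e7 := Fintype.sum_of_injective Φ hΦ
    (fun q => (4 - ({y | (Quotient.mk _ y : PermCycles G.faceNext) = q}.ncard : ℤ)))
    (fun q => (4 - ({y | (Quotient.mk _ y : PermCycles s.face) = q}.ncard : ℤ)))
    (by
      intro q hq
      induction q using Quotient.inductionOn with | h x =>
      rcases x.2.eq_center_or s.triQuad with ⟨d, hd⟩ | h4
      · refine absurd ⟨Quotient.mk _ d, ?_⟩ hq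
        exact congrArg (Quotient.mk _) (Subtype.ext hd.symm)
      · rw [PermCycles.ncard_fiber, (minimalPeriod_eq_four_iff (p := s.face)).mpr]
        · norm_num
        · refine ⟨Subtype.ext (by simpa using h4.1), fun h5 => h4.2 ?_⟩
          simpa using congrArg Subtype.val h5)
    (by
      intro q
      induction q using Quotient.inductionOn with | h d =>
      change _ = (4 - ({y | (Quotient.mk _ y : PermCycles s.face) = Quotient.mk _ (c d)}.ncard : ℤ))
      rw [PermCycles.ncard_fiber, PermCycles.ncard_fiber, minimalPeriod_eq_of_injective hc hcf])
  have e8 := G.euler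
  change Nat.card (PermCycles s.rot) + Nat.card (PermCycles s.face) = _
  change Nat.card (PermCycles G.rot) + Nat.card (PermCycles G.faceNext) = _ at e8
  omega

/-- The plane graph with the strands added. -/
def graph : PlaneGraph (StrandDarts G k) where
  rot := s.rot
  inv := s.inv
  finite := finite_strandDarts
  inv_inv x := Subtype.ext (flip_flip s.balanced x.2)
  inv_ne x h1 := flip_ne x.1 (congrArg Subtype.val h1)
  connected := s.linked
  euler := s.euler

end Strands

/-! ### 2-connectedness of the new graph -/

theorem eq_or_of_tail_eq (h4 : ∀ d, G.rot (G.rot (G.rot (G.rot d))) = d) {d e : D}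
    (hde : G.tail e = G.tail d) : e = d ∨ e = G.rot.symm d ∨ e = G.rot.symm (G.rot.symm d) ∨
      e = G.rot.symm (G.rot.symm (G.rot.symm d)) := by
  have := G.finite
  refine Equiv.Perm.SameCycle.mem_of_forall (p := G.rot)
    (S := fun e => e = d ∨ e = G.rot.symm d ∨ e = G.rot.symm (G.rot.symm d) ∨
      e = G.rot.symm (G.rot.symm (G.rot.symm d))) ?_ (G.tail_eq_iff.mp hde.symm) (Or.inl rfl)
  rintro x (rfl | rfl | rfl | rfl)
  · refine Or.inr (Or.inr (Or.inr ?_))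
    simp only [Equiv.eq_symm_apply, h4]
  · simp
  · simp
  · simp

/-- Two vertices are joined by a path that avoids the vertex `x`. -/
def JoinedAvoiding (G : PlaneGraph D) (x y z : G.Vertex) : Prop :=
  ∃ (hy : y ≠ x) (hz : z ≠ x),
    (G.skeleton.induce {y | y ≠ x}).Reachable ⟨y, hy⟩ ⟨z, hz⟩

namespace JoinedAvoiding

variable {x y z w : G.Vertex}

theorem refl (hy : y ≠ x) : G.JoinedAvoiding x y y := ⟨hy, hy, SimpleGraph.Reachable.rfl⟩

theorem symm : G.JoinedAvoiding x y z → G.JoinedAvoiding x z y :=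
  fun ⟨hy, hz, h⟩ => ⟨hz, hy, h.symm⟩

theorem trans : G.JoinedAvoiding x y z → G.JoinedAvoiding x z w → G.JoinedAvoiding x y w :=
  fun ⟨hy, _, h⟩ ⟨_, hw, h'⟩ => ⟨hy, hw, h.trans h'⟩

theorem edge {d : D} (h1 : G.tail d ≠ x) (h2 : G.tail (G.inv d) ≠ x) :
    G.JoinedAvoiding x (G.tail d) (G.tail (G.inv d)) := by
  by_cases h : G.tail d = G.tail (G.inv d)
  · rw [← h]; exact refl h1
  · refine ⟨h1, h2, SimpleGraph.Adj.reachable ?_⟩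
    rw [SimpleGraph.comap_adj]
    exact (SimpleGraph.fromRel_adj _ _ _).mpr ⟨h, Or.inl ⟨d, rfl, rfl⟩⟩

end JoinedAvoiding

theorem exists_tail_eq (x : G.Vertex) : ∃ d, G.tail d = x := Quotient.exists_rep x

/-- Around the vertex `x`, the neighbours are joined along the boundaries of the faces, if none of
these faces passes through `x` twice. -/
theorem connected_induce_of_faces (h : G.IsTriQuad) {x : G.Vertex}
    (hx : ∀ d, G.tail d = x → G.tail (G.faceNext (G.faceNext d)) ≠ x) :
    (G.skeleton.induce {y | y ≠ x}).Connected := by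
  have := G.finite
  obtain ⟨d₀, rfl⟩ := exists_tail_eq x
  have hne : ∀ d, G.tail d = G.tail d₀ → G.tail (G.inv d) ≠ G.tail d₀ := fun d hd h1 =>
    h.loopless d (h1.trans hd.symm)
  have hstep : ∀ d, G.tail d = G.tail d₀ →
      G.JoinedAvoiding (G.tail d₀) (G.tail (G.inv (G.rot d))) (G.tail (G.inv d)) := by
    intro d hd
    have hd1 := hne _ hd
    have hd2 := hne (G.rot d) (by rw [tail_rot, hd])
    change _ ≠ _ at hd2
    have e1 : G.inv (G.rot d) = G.facePrev d := rfl
    rw [e1] at hd2 ⊢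
    rw [← tail_faceNext] at hd1 ⊢
    have hd3 := hx d hd
    have s1 := JoinedAvoiding.edge hd1 (by rwa [← tail_faceNext])
    rw [← tail_faceNext] at s1
    rcases h.face d with h3 | h4
    · have e2 : G.facePrev d = G.faceNext (G.faceNext d) := by
        conv_lhs => rw [← IsTriQuad.faceNext_three h3, facePrev_faceNext]
      rw [e2]
      exact s1.symm
    · have e2 : G.facePrev d = G.faceNext (G.faceNext (G.faceNext d)) := by
        conv_lhs => rw [← IsTriQuad.faceNext_four h4, facePrev_faceNext]
      rw [e2] at hd2 ⊢
      have s2 := JoinedAvoiding.edge hd3 (by rwa [← tail_faceNext])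
      rw [← tail_faceNext] at s2
      exact (s1.trans s2).symm
  have hnb : ∀ d, G.tail d = G.tail d₀ →
      G.JoinedAvoiding (G.tail d₀) (G.tail (G.inv d)) (G.tail (G.inv d₀)) := by
    intro d hd
    refine (Equiv.Perm.SameCycle.mem_of_forall (p := G.rot) (S := fun d =>
      G.tail d = G.tail d₀ ∧
        G.JoinedAvoiding (G.tail d₀) (G.tail (G.inv d)) (G.tail (G.inv d₀))) ?_
        (G.tail_eq_iff.mp hd.symm) ⟨rfl, JoinedAvoiding.refl (hne _ rfl)⟩).2
    rintro e ⟨he1, he2⟩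
    exact ⟨by rw [tail_rot, he1], (hstep e he1).trans he2⟩
  have hinv : ∀ d, (G.tail d = G.tail d₀ ∨
        G.JoinedAvoiding (G.tail d₀) (G.tail d) (G.tail (G.inv d₀))) →
      (G.tail (G.inv d) = G.tail d₀ ∨
        G.JoinedAvoiding (G.tail d₀) (G.tail (G.inv d)) (G.tail (G.inv d₀))) := by
    rintro d (hd | hd)
    · exact Or.inr (hnb d hd)
    · by_cases h1 : G.tail (G.inv d) = G.tail d₀
      · exact Or.inl h1
      · exact Or.inr ((JoinedAvoiding.edge hd.1 h1).symm.trans hd)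
  -- Being at the removed vertex or joined to its fixed neighbour is invariant under both
  -- generators; connectedness then spreads it to all darts.
  have hall : ∀ g ∈ Subgroup.closure {G.rot, G.inv}, ∀ d, (G.tail d = G.tail d₀ ∨
        G.JoinedAvoiding (G.tail d₀) (G.tail d) (G.tail (G.inv d₀))) ↔
      (G.tail (g d) = G.tail d₀ ∨
        G.JoinedAvoiding (G.tail d₀) (G.tail (g d)) (G.tail (G.inv d₀))) := by
    intro g hg
    induction hg using Subgroup.closure_induction with
    | mem g hg =>
      intro d
      rcases hg with rfl | rfl
      · rw [tail_rot]
      · exact ⟨hinv d, fun h1 => by simpa using hinv _ h1⟩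
    | one => exact fun d => Iff.rfl
    | mul g g' _ _ h h' => exact fun d => (h' d).trans (h _)
    | inv g _ h => exact fun d => by simpa using (h (g⁻¹ d)).symm
  have hjoin : ∀ y, y ≠ G.tail d₀ → G.JoinedAvoiding (G.tail d₀) y (G.tail (G.inv d₀)) := by
    intro y hy
    obtain ⟨e, rfl⟩ := exists_tail_eq y
    obtain ⟨g, hg, rfl⟩ := G.connected d₀ e
    exact ((hall g hg d₀).mp (Or.inl rfl)).resolve_left hy
  refine (SimpleGraph.connected_iff _).mpr ⟨?_, ?_⟩
  · rintro ⟨y, hy⟩ ⟨z, hz⟩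
    obtain ⟨_, _, h1⟩ := (hjoin y hy).trans (hjoin z hz).symm
    exact h1
  · exact ⟨⟨_, hne _ rfl⟩⟩

theorem skeleton_connected (d₀ : D) : G.skeleton.Connected := by
  have hinv : ∀ d, G.skeleton.Reachable (G.tail d) (G.tail (G.inv d)) := by
    intro d
    by_cases h : G.tail d = G.tail (G.inv d)
    · rw [← h]
    · exact SimpleGraph.Adj.reachable
        ((SimpleGraph.fromRel_adj _ _ _).mpr ⟨h, Or.inl ⟨d, rfl, rfl⟩⟩)
  have hall : ∀ g ∈ Subgroup.closure {G.rot, G.inv}, ∀ d,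
      G.skeleton.Reachable (G.tail d) (G.tail (g d)) := by
    intro g hg
    induction hg using Subgroup.closure_induction with
    | mem g hg =>
      intro d
      rcases hg with rfl | rfl
      · rw [tail_rot]
      · exact hinv d
    | one => exact fun d => SimpleGraph.Reachable.rfl
    | mul g g' _ _ h h' => exact fun d => (h' d).trans (h _)
    | inv g _ h => exact fun d => by simpa using (h (g⁻¹ d)).symm
  refine (SimpleGraph.connected_iff _).mpr ⟨?_, ⟨G.tail d₀⟩⟩
  intro y z
  obtain ⟨d, rfl⟩ := exists_tail_eq y
  obtain ⟨e, rfl⟩ := exists_tail_eq z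
  obtain ⟨g, hg, rfl⟩ := G.connected d e
  exact hall g hg d

theorem mem_of_induce_connected {x : G.Vertex} (h : (G.skeleton.induce {y | y ≠ x}).Connected)
    {Q : G.Vertex → Prop}
    (hQ : ∀ d, G.tail d ≠ x → G.tail (G.inv d) ≠ x → Q (G.tail d) → Q (G.tail (G.inv d)))
    {y z : G.Vertex} (hy : y ≠ x) (hz : z ≠ x) (h1 : Q y) : Q z := by
  obtain ⟨w⟩ := h.preconnected ⟨y, hy⟩ ⟨z, hz⟩
  have hu : ∀ a : {y | y ≠ x}, (a : G.Vertex) ≠ x := fun a => a.2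
  have key : ∀ a b : {y | y ≠ x}, (G.skeleton.induce {y | y ≠ x}).Walk a b → Q a → Q b := by
    intro a b w
    induction w with
    | nil => exact id
    | cons hab _ ih =>
      intro ha
      refine ih ?_
      rw [SimpleGraph.comap_adj] at hab
      obtain ⟨-, ⟨d, hd1, hd2⟩ | ⟨d, hd1, hd2⟩⟩ := (SimpleGraph.fromRel_adj _ _ _).mp hab
      · have := hQ d (by rw [hd1]; exact hu _) (by rw [hd2]; exact hu _)
          (by rw [hd1]; exact ha)
        rwa [hd2] at this
      · have := hQ (G.inv d) (by rw [hd2]; exact hu _)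
          (by rw [inv_inv_apply, hd1]; exact hu _) (by rw [hd2]; exact ha)
        rwa [inv_inv_apply, hd1] at this
  exact key _ _ w h1

theorem IsTriQuad.isHedrite (h : G.IsTriQuad) (d₀ : D)
    (h2 : ∀ x : G.Vertex, (G.skeleton.induce {y | y ≠ x}).Connected) : G.IsHedrite 8 := by
  have hf : ∀ F, G.gonality F = 3 ∨ G.gonality F = 4 := by
    intro F
    obtain ⟨d, rfl⟩ := Quotient.exists_rep F
    exact h.face d
  refine ⟨⟨skeleton_connected d₀, h.loopless, h2⟩, ?_, fun F => Or.inr (hf F), ?_⟩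
  · intro x
    obtain ⟨d, rfl⟩ := exists_tail_eq x
    rw [degree_tail, h.minimalPeriod_rot]
  · have : {F : G.Face | G.gonality F = 2} = ∅ := by
      ext F
      have := hf F
      simp only [Set.mem_ofPred_eq, Set.mem_empty_iff_false, iff_false]
      omega
    rw [numFaces, this, Set.ncard_empty]

/-- The reversal of a loop would be one of the four darts at its tail. It is not the loop itself;
opposite to the loop, it makes `straight` fix it; next to the loop on either side, it gives a 1-gon.
-/
theorem loopless_of_straight_ne (h4 : ∀ d, G.rot (G.rot (G.rot (G.rot d))) = d)
    (hf : ∀ d, G.faceNext d ≠ d) (hs : ∀ d, G.straight d ≠ d) (d : D) :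
    G.tail (G.inv d) ≠ G.tail d := by
  intro h
  rcases eq_or_of_tail_eq h4 h with h | h | h | h
  · exact G.inv_ne d h
  · refine hf (G.inv d) ?_
    rw [faceNext_apply, inv_inv_apply, h]
  · refine hs d ?_
    rw [straight_apply, h]
    simp
  · refine hf d ?_
    rw [faceNext_apply, h]
    simp only [Equiv.symm_apply_eq, h4]

namespace StrandDart

/-- No face has a crossing of two strands at two diagonal corners. The four darts at the crossing
are listed explicitly, and two steps along the face never lead from one to another. -/
theorem inner_opposite (h : G.IsTriQuad) {d : D} {j i : ℕ} (hj : j < k d)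
    (hi : i < k (G.facePrev d)) {y z : StrandDart D}
    (hy : y = fwd d (j + 1) (i + 1) ∨
      y = fwd (G.facePrev d) (i + 1) (G.width k (G.facePrev d) - j) ∨ y = bwd d j i ∨
      y = bwd (G.facePrev d) i (G.width k (G.facePrev d) - (j + 1)))
    (hz : z = fwd d (j + 1) (i + 1) ∨
      z = fwd (G.facePrev d) (i + 1) (G.width k (G.facePrev d) - j) ∨ z = bwd d j i ∨
      z = bwd (G.facePrev d) i (G.width k (G.facePrev d) - (j + 1))) :
    face G k (face G k y) ≠ z := by
  have w1 := width_eq (G := G) (k := k) d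
  have w2 := width_facePrev (G := G) (k := k) d
  have hp : G.facePrev d ≠ d := fun h1 => h.faceNext_ne d (by
    conv_lhs => rw [← h1]
    simp)
  have hpp : G.facePrev (G.facePrev d) ≠ d := fun h1 => h.faceNext_faceNext_ne d (by
    conv_lhs => rw [← h1]
    simp)
  have hppp : G.facePrev (G.facePrev d) ≠ G.facePrev d := fun h1 => hp (by
    have := congrArg G.faceNext h1
    simpa using this)
  rcases hy with rfl | rfl | rfl | rfl
  · rcases Nat.lt_or_ge (j + 1) (k d) with hlt | hge
    · rw [face_face_fwd_of_lt hlt (by omega)]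
      rcases hz with rfl | rfl | rfl | rfl <;> simp [hp.symm]
    · obtain hjk : k d = j + 1 := by omega
      rw [← hjk]
      rcases Nat.lt_or_ge (i + 1) (k (G.facePrev d)) with hlt | hge
      · rw [face_face_last_of_lt hlt]
        rcases hz with rfl | rfl | rfl | rfl <;> simp [hpp, hppp]
      · rw [face_face_last_of_le hge]
        rcases hz with rfl | rfl | rfl | rfl
        · simp [h.faceNext_faceNext_ne]
        · intro h1
          injection h1 with h1 h2 h3
          have h4 : G.facePrev (G.facePrev d) = G.faceNext d := by
            rw [← h1, facePrev_faceNext]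
          rw [h4] at w2
          omega
        · simp
        · simp
  · rcases Nat.lt_or_ge (i + 1) (k (G.facePrev d)) with hlt | hge
    · rw [face_face_fwd_of_lt hlt (by omega)]
      rcases hz with rfl | rfl | rfl | rfl <;> simp [hp]
    · obtain hik : k (G.facePrev d) = i + 1 := by omega
      rw [← hik, face_face_last_of_le (by omega), faceNext_facePrev]
      rcases hz with rfl | rfl | rfl | rfl
      · simp [h.faceNext_ne]
      · intro h1
        injection h1 with h1 h2 h3
        refine h.faceNext_faceNext_ne d ?_
        rw [h1, faceNext_facePrev]
      · simp
      · simp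
  · rw [face_face_bwd hj (by omega)]
    rcases hz with rfl | rfl | rfl | rfl <;> simp [hp.symm]
  · rw [face_face_bwd hi (by omega)]
    rcases hz with rfl | rfl | rfl | rfl <;> simp [hp]

theorem faceNext_three_ne_inv (h : G.IsTriQuad) (d : D) :
    G.faceNext (G.faceNext (G.faceNext d)) ≠ G.inv d := by
  intro h1
  rcases h.face d with h3 | h4
  · rw [IsTriQuad.faceNext_three h3] at h1
    exact G.inv_ne d h1.symm
  · have := IsTriQuad.faceNext_four h4
    rw [h1] at this
    exact h.faceNext_ne_inv (G.inv d) (by rw [this, inv_inv_apply])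

/-- The same for a crossing on an old edge, starting from the two darts whose left faces are inside
the left face of `d`. The other two follow by exchanging `d` with `inv d`. -/
theorem edge_opposite_aux (h : G.IsTriQuad) (hk : G.Balanced k) {d : D} {i : ℕ}
    (hi : i < G.width k d) {y z : StrandDart D}
    (hy : y = fwd d 0 (i + 1) ∨ y = enter G k d i)
    (hz : z = fwd d 0 (i + 1) ∨ z = enter G k (G.inv d) (G.width k d - (i + 1)) ∨
      z = fwd (G.inv d) 0 (G.width k d - i) ∨ z = enter G k d i) :
    face G k (face G k y) ≠ z := by
  have w1 := width_eq (G := G) (k := k) d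
  have w2 := width_facePrev (G := G) (k := k) d
  have w3 := width_faceNext (G := G) (k := k) d
  have w4 := hk d
  have w5 := width_eq (G := G) (k := k) (G.inv d)
  have hp : G.facePrev d ≠ d := fun h1 => h.faceNext_ne d (by
    conv_lhs => rw [← h1]
    simp)
  have hpp : G.facePrev (G.facePrev d) ≠ d := fun h1 => h.faceNext_faceNext_ne d (by
    conv_lhs => rw [← h1]
    simp)
  have hpi : G.facePrev d ≠ G.inv d := fun h1 => h.faceNext_ne_inv (G.inv d) (by
    rw [← h1, faceNext_facePrev, h1, inv_inv_apply])
  have hppi : G.facePrev (G.facePrev d) ≠ G.inv d := fun h1 =>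
    h.faceNext_faceNext_ne_inv (G.inv d) (by
      rw [← h1, faceNext_facePrev, faceNext_facePrev, h1, inv_inv_apply])
  have hpfi : G.facePrev (G.inv d) ≠ d := fun h1 => h.faceNext_ne_inv d (by
    conv_lhs => rw [← h1]
    simp)
  have hppfi : G.facePrev (G.facePrev d) ≠ G.faceNext (G.inv d) := fun h1 => by
    have := congrArg (fun e => G.faceNext (G.faceNext e)) h1
    simp only [faceNext_facePrev] at this
    exact faceNext_three_ne_inv h (G.inv d) (by rw [← this, inv_inv_apply])
  have hz' : z = fwd d 0 (i + 1) ∨ z = fwd (G.inv d) 0 (G.width k d - i) ∨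
      z = bwd (G.facePrev (G.inv d)) (G.width k d - (i + 1))
          (G.width k (G.facePrev (G.inv d))) ∨
      z = fwd (G.faceNext (G.inv d)) (i + 1) 0 ∨
      (i < k (G.facePrev d) ∧ z = bwd (G.facePrev d) i (G.width k (G.facePrev d))) ∨
      (k (G.facePrev d) ≤ i ∧ z = fwd (G.faceNext d) (G.width k d - i) 0) := by
    rcases hz with hz | hz | hz | hz
    · simp [hz]
    · rcases Nat.lt_or_ge (G.width k d - (i + 1)) (k (G.facePrev (G.inv d))) with h1 | h1
      · rw [enter_of_lt h1] at hz; simp [hz]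
      · rw [enter_of_le h1, show G.width k (G.inv d) - (G.width k d - (i + 1)) = i + 1 by omega]
          at hz
        simp [hz]
    · simp [hz]
    · rcases Nat.lt_or_ge i (k (G.facePrev d)) with h1 | h1
      · rw [enter_of_lt h1] at hz; simp [hz, h1]
      · rw [enter_of_le h1] at hz; simp [hz, h1]
  clear hz
  rcases hy with rfl | rfl
  · rcases Nat.eq_zero_or_pos (k d) with h0 | hpos
    · rcases Nat.lt_or_ge (i + 1) (k (G.facePrev d)) with hlt | hge
      · have e := face_face_last_of_lt hlt
        rw [h0] at e
        rw [e]
        rcases hz' with rfl | rfl | rfl | rfl | ⟨h1, rfl⟩ | ⟨h1, rfl⟩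
        · simp [hpp]
        · simp [hppi]
        · simp
        · simp [hppfi]
        · simp
        · omega
      · have e := face_face_last_of_le hge
        rw [h0] at e
        rw [e]
        rcases hz' with rfl | rfl | rfl | rfl | ⟨h1, rfl⟩ | ⟨h1, rfl⟩
        · simp [h.faceNext_faceNext_ne]
        · simp [h.faceNext_faceNext_ne_inv]
        · simp
        · simp [h.faceNext_ne_inv]
        · simp
        · simp [h.faceNext_ne]
    · rw [face_face_fwd_of_lt hpos hi]
      rcases hz' with rfl | rfl | rfl | rfl | ⟨h1, rfl⟩ | ⟨h1, rfl⟩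
      · simp
      · simp
      · simp [hpfi.symm]
      · simp
      · simp [hp.symm]
      · simp
  · rcases Nat.lt_or_ge i (k (G.facePrev d)) with hlt | hge
    · rw [enter_of_lt hlt, face_face_bwd hlt le_rfl]
      rcases hz' with rfl | rfl | rfl | rfl | ⟨h1, rfl⟩ | ⟨h1, rfl⟩
      · simp [hp]
      · simp [hpi]
      · simp
      · intro h1; injection h1 with h1 h2; omega
      · simp
      · omega
    · rw [enter_of_le hge]
      rcases Nat.lt_or_ge (G.width k d - i) (k (G.faceNext d)) with h1 | h1
      · rw [face_face_fwd_of_lt h1 (Nat.zero_le _)]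
        rcases hz' with rfl | rfl | rfl | rfl | ⟨h1, rfl⟩ | ⟨h1, rfl⟩
        · simp
        · simp
        · intro h1; injection h1 with h1 h2; omega
        · simp
        · omega
        · simp
      · have e0 : G.width k d - i = k (G.faceNext d) := by omega
        rw [e0]
        rcases Nat.eq_zero_or_pos (k d) with h0 | hpos
        · rw [face_face_last_of_le (by rw [facePrev_faceNext, h0])]
          rcases hz' with rfl | rfl | rfl | rfl | ⟨h1, rfl⟩ | ⟨h1, rfl⟩
          · intro h2
            injection h2 with h2 h3 h4
            have := congrArg G.facePrev h2
            rw [facePrev_faceNext] at this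
            rw [this] at w3
            omega
          · simp [faceNext_three_ne_inv h]
          · simp
          · simp [h.faceNext_faceNext_ne_inv]
          · omega
          · simp [h.faceNext_faceNext_ne]
        · rw [face_face_last_of_lt (by rwa [facePrev_faceNext]), facePrev_faceNext]
          rcases hz' with rfl | rfl | rfl | rfl | ⟨h1, rfl⟩ | ⟨h1, rfl⟩
          · simp [hp]
          · simp [hpi]
          · simp
          · intro h2; injection h2 with h2 h3; omega
          · omega
          · intro h2
            injection h2 with h2 h3
            refine h.faceNext_faceNext_ne d ?_
            rw [← h2, faceNext_facePrev]

theorem edge_opposite (h : G.IsTriQuad) (hk : G.Balanced k) {d : D} {i : ℕ}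
    (hi : i < G.width k d) {y z : StrandDart D}
    (hy : y = fwd d 0 (i + 1) ∨ y = enter G k (G.inv d) (G.width k d - (i + 1)) ∨
      y = fwd (G.inv d) 0 (G.width k d - i) ∨ y = enter G k d i)
    (hz : z = fwd d 0 (i + 1) ∨ z = enter G k (G.inv d) (G.width k d - (i + 1)) ∨
      z = fwd (G.inv d) 0 (G.width k d - i) ∨ z = enter G k d i) :
    face G k (face G k y) ≠ z := by
  have hsymm := edge_opposite_aux h hk (d := G.inv d) (i := G.width k d - (i + 1)) (y := y)
    (z := z) (by rw [hk]; omega)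
  rw [inv_inv_apply, hk, show G.width k d - (i + 1) + 1 = G.width k d - i by omega,
    show G.width k d - (G.width k d - i) = i by omega,
    show G.width k d - (G.width k d - (i + 1)) = i + 1 by omega] at hsymm
  have haux := edge_opposite_aux h hk hi (y := y) (z := z)
  tauto

end StrandDart

@[simp] theorem tail_rot_symm (d : D) : G.tail (G.rot.symm d) = G.tail d := by
  rw [← tail_rot, Equiv.apply_symm_apply]

namespace Strands

variable (s : G.Strands k)

@[simp] theorem graph_rot : s.graph.rot = s.rot := rfl

@[simp] theorem graph_inv : s.graph.inv = s.inv := rfl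

@[simp] theorem graph_faceNext : s.graph.faceNext = s.face := rfl

@[simp] theorem graph_straight : s.graph.straight = s.straight := rfl

theorem inv_inv (x : StrandDarts G k) : s.inv (s.inv x) = x := s.graph.inv_inv x

theorem face_ne (x : StrandDarts G k) : s.face x ≠ x := by
  intro h1
  have h2 := congrArg Subtype.val h1
  rw [coe_face] at h2
  rcases x.2.eq_center_or s.triQuad with ⟨d, hd⟩ | h4
  · rw [hd, face_center] at h2
    exact s.triQuad.faceNext_ne d (center_injective h2)
  · exact h4.2 (by rw [h2, h2])

/-- Within a line the piece number grows. At its end one passes to a strand dart of the other kind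
or to the line of `straight d`, and `straight d = d` would make `d` a loop. Reversed darts reduce to
this case. -/
theorem straight_ne (x : StrandDarts G k) : s.straight x ≠ x := by
  have key : ∀ (d : D) (j i : ℕ) (hj : j ≤ k d) (hi : i ≤ G.width k d),
      s.straight ⟨fwd d j i, hj, hi⟩ ≠ ⟨fwd d j i, hj, hi⟩ := by
    intro d j i hj hi h1
    rcases Nat.eq_or_lt_of_le hi with rfl | hlt
    · have h2 := congrArg Subtype.val h1
      rw [coe_straight] at h2
      dsimp only at h2
      rw [cw_face_last, cw_edge] at h2
      rcases Nat.lt_or_ge (G.width k (G.faceNext d) - j)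
        (k (G.facePrev (G.inv (G.faceNext d)))) with h3 | h3
      · rw [enter_of_lt h3] at h2
        cases h2
      · rw [enter_of_le h3, ← s.triQuad.straight_eq] at h2
        injection h2 with h2
        refine s.triQuad.loopless d ?_
        conv_rhs => rw [← h2, straight_apply, tail_rot, tail_rot]
    · rw [s.straight_fwd hj hlt] at h1
      have h2 := congrArg Subtype.val h1
      injection h2 with _ _ h2
      omega
  match x with
  | ⟨fwd d j i, hj, hi⟩ => exact key d j i hj hi
  | ⟨bwd d j i, hj, hi⟩ =>
    intro h1
    refine key d (j + 1) i hj hi ?_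
    have h2 : (⟨fwd d (j + 1) i, hj, hi⟩ : StrandDarts G k) = s.inv ⟨bwd d j i, hj, hi⟩ := rfl
    rw [h2]
    set x : StrandDarts G k := ⟨bwd d j i, hj, hi⟩
    change s.rot (s.rot (s.inv (s.inv x))) = _
    rw [s.inv_inv]
    have h3 : s.rot (s.rot (s.inv x)) = x := h1
    conv_lhs => rw [← h3]
    exact s.rot_four _

theorem gonality_center (d : D) :
    s.graph.gonality (s.graph.leftFace ⟨center G k d, center_valid d⟩) =
      G.gonality (G.leftFace d) := by
  rw [gonality_leftFace, gonality_leftFace]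
  refine minimalPeriod_eq_of_injective
    (c := fun d => (⟨center G k d, center_valid d⟩ : StrandDarts G k))
    (fun d e h => center_injective (congrArg Subtype.val h)) (fun d => Subtype.ext ?_) d
  rw [graph_faceNext, coe_face]
  exact face_center d

theorem isTriQuad : s.graph.IsTriQuad where
  rot_four := s.rot_four
  rot_rot_ne := s.rot_rot_ne
  loopless := loopless_of_straight_ne s.rot_four s.face_ne s.straight_ne
  face x := by
    rcases x.2.eq_center_or s.triQuad with ⟨d, hd⟩ | h4
    · have := s.gonality_center d
      rw [show x = ⟨center G k d, center_valid d⟩ from Subtype.ext hd, this]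
      exact s.triQuad.face d
    · right
      rw [gonality_leftFace]
      refine minimalPeriod_eq_four_iff.mpr ⟨Subtype.ext ?_, fun h5 => h4.2 ?_⟩
      · simpa using h4.1
      · simpa using congrArg Subtype.val h5

theorem tail_base_eq_iff {d e : D} :
    s.graph.tail (base G k d) = s.graph.tail (base G k e) ↔ G.tail d = G.tail e := by
  have := finite_strandDarts (G := G) (k := k)
  rw [tail_eq_iff, tail_eq_iff]
  refine Equiv.Perm.sameCycle_of_injective ?_ s.rot_base
  intro d e h
  have := congrArg Subtype.val h
  injection this

theorem eq_base_of_tail_eq {x : StrandDarts G k} {d : D}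
    (h : s.graph.tail x = s.graph.tail (base G k d)) : ∃ e, x = base G k e := by
  have := finite_strandDarts (G := G) (k := k)
  refine Equiv.Perm.SameCycle.mem_of_forall (p := s.rot) (S := fun x => ∃ e, x = base G k e)
    ?_ (s.graph.tail_eq_iff.mp h.symm) ⟨d, rfl⟩
  rintro _ ⟨e, rfl⟩
  exact ⟨_, s.rot_base e⟩

/-- Together with looplessness, this says that no face passes twice through a new vertex, so such a
vertex can be bypassed along the faces around it. -/
theorem opposite {x : StrandDarts G k} (hx : ∀ d, s.graph.tail x ≠ s.graph.tail (base G k d))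
    {y : StrandDarts G k} (hy : s.graph.tail y = s.graph.tail x) :
    s.graph.tail (s.face (s.face y)) ≠ s.graph.tail x := by
  have key : ∀ x : StrandDart D, Valid G k x → ∀ hx : Valid G k x,
      (∀ d, s.graph.tail ⟨x, hx⟩ ≠ s.graph.tail (base G k d)) → ∀ y : StrandDarts G k,
      s.graph.tail y = s.graph.tail ⟨x, hx⟩ →
      s.graph.tail (s.face (s.face y)) ≠ s.graph.tail ⟨x, hx⟩ := by
    intro x hx
    refine Valid.vertex_cases (P := fun x => ∀ hx : Valid G k x,
      (∀ d, s.graph.tail ⟨x, hx⟩ ≠ s.graph.tail (base G k d)) → ∀ y : StrandDarts G k,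
      s.graph.tail y = s.graph.tail ⟨x, hx⟩ →
      s.graph.tail (s.face (s.face y)) ≠ s.graph.tail ⟨x, hx⟩) s.balanced ?_ ?_ ?_ ?_ hx
    · intro x hx ih hx' hd y hy
      have := s.graph.tail_rot_symm ⟨x, hx⟩
      rw [graph_rot] at this
      have e : s.rot.symm ⟨x, hx⟩ = ⟨cw (G := G) (k := k) x, hx'⟩ := rfl
      rw [e] at this
      rw [this] at hy ⊢
      exact ih hx (fun d => this ▸ hd d) y hy
    · intro d hx hd
      exact absurd rfl (hd d)
    · intro d i hi hx _ y hy hz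
      have e1 : (s.rot.symm ⟨fwd d 0 (i + 1), hx⟩).1 =
          enter G k (G.inv d) (G.width k d - (i + 1)) := rfl
      have e2 : (s.rot.symm (s.rot.symm ⟨fwd d 0 (i + 1), hx⟩)).1 =
          fwd (G.inv d) 0 (G.width k d - i) := cw_cw_edge s.balanced hi
      have e3 : (s.rot.symm (s.rot.symm (s.rot.symm ⟨fwd d 0 (i + 1), hx⟩))).1 =
          enter G k d i := by
        rw [coe_rot_symm, e2, cw_edge, inv_inv_apply, s.balanced]
        congr 1; omega
      have hy' := eq_or_of_tail_eq s.rot_four hy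
      have hz' := eq_or_of_tail_eq s.rot_four hz
      simp only [graph_rot, Subtype.ext_iff, e1, e2, e3] at hy' hz'
      exact edge_opposite s.triQuad s.balanced hi hy' hz' (by simp)
    · intro d j i hj hi hx _ y hy hz
      have e1 : (s.rot.symm ⟨fwd d (j + 1) (i + 1), hx⟩).1 =
          fwd (G.facePrev d) (i + 1) (G.width k (G.facePrev d) - j) := cw_inner_one hi
      have e2 : (s.rot.symm (s.rot.symm ⟨fwd d (j + 1) (i + 1), hx⟩)).1 = bwd d j i := by
        rw [coe_rot_symm, e1, cw_inner_two hj]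
      have e3 : (s.rot.symm (s.rot.symm (s.rot.symm ⟨fwd d (j + 1) (i + 1), hx⟩))).1 =
          bwd (G.facePrev d) i (G.width k (G.facePrev d) - (j + 1)) := by
        rw [coe_rot_symm, e2, cw_inner_three hi]
      have hy' := eq_or_of_tail_eq s.rot_four hy
      have hz' := eq_or_of_tail_eq s.rot_four hz
      simp only [graph_rot, Subtype.ext_iff, e1, e2, e3] at hy' hz'
      exact inner_opposite s.triQuad hj hi hy' hz' (by simp)
  exact key x.1 x.2 x.2 hx y hy

theorem joined_line (x₀ : s.graph.Vertex) {d : D} {j : ℕ} (hj : j ≤ k d)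
    (hx : ∀ (i : ℕ) (hi : i ≤ G.width k d), s.graph.tail ⟨fwd d j i, hj, hi⟩ ≠ x₀) (i : ℕ)
    (hi : i ≤ G.width k d) :
    s.graph.JoinedAvoiding x₀ (s.graph.tail ⟨fwd d j 0, hj, Nat.zero_le _⟩)
      (s.graph.tail ⟨fwd d j i, hj, hi⟩) := by
  induction i with
  | zero => exact JoinedAvoiding.refl (hx 0 (Nat.zero_le _))
  | succ i ih =>
    refine (ih (by omega)).trans ?_
    have e : s.graph.tail ⟨fwd d j (i + 1), hj, hi⟩ =
        s.graph.tail (s.graph.inv ⟨fwd d j i, hj, by omega⟩) := by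
      rw [← s.straight_fwd hj hi]
      change s.graph.tail (s.graph.rot (s.graph.rot (s.graph.inv _))) = _
      rw [tail_rot, tail_rot]
    rw [e]
    refine JoinedAvoiding.edge (hx _ (by omega)) ?_
    rw [← e]
    exact hx _ hi

theorem fwd_succ_tail_ne_base {d e : D} {j i : ℕ} (hx : Valid G k (fwd d j i))
    (hji : j ≠ 0 ∨ i ≠ 0) : s.graph.tail ⟨fwd d j i, hx⟩ ≠ s.graph.tail (base G k e) := by
  intro h
  obtain ⟨f, hf⟩ := s.eq_base_of_tail_eq h
  have := congrArg Subtype.val hf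
  rw [coe_base] at this
  injection this
  omega

theorem tail_edge {d : D} {i : ℕ} (hi : i < G.width k d) :
    s.graph.tail ⟨fwd d 0 (i + 1), Nat.zero_le _, hi⟩ =
      s.graph.tail ⟨fwd (G.inv d) 0 (G.width k d - i), Nat.zero_le _, by
        rw [s.balanced]; omega⟩ := by
  have e : s.graph.rot.symm (s.graph.rot.symm ⟨fwd d 0 (i + 1), Nat.zero_le _, hi⟩) =
      ⟨fwd (G.inv d) 0 (G.width k d - i), Nat.zero_le _, by rw [s.balanced]; omega⟩ :=
    Subtype.ext (cw_cw_edge s.balanced hi)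
  rw [← e, tail_rot_symm, tail_rot_symm]

theorem tail_line_zero {d : D} {j : ℕ} (hj : j < k d) :
    ∃ (e : D) (i : ℕ) (hi : i < G.width k e),
      s.graph.tail ⟨fwd d (j + 1) 0, hj, Nat.zero_le _⟩ =
        s.graph.tail ⟨fwd e 0 (i + 1), Nat.zero_le _, hi⟩ := by
  have h2 := width_facePrev (G := G) (k := k) d
  have := enter_of_le (G := G) (k := k) (d := G.facePrev d)
    (i := G.width k (G.facePrev d) - (j + 1)) (by omega)
  rw [faceNext_facePrev,
    show G.width k (G.facePrev d) - (G.width k (G.facePrev d) - (j + 1)) = j + 1 by omega] at this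
  have hlt : G.width k (G.facePrev d) - (j + 1) < G.width k (G.facePrev d) := by omega
  refine ⟨G.facePrev d, G.width k (G.facePrev d) - (j + 1), hlt, ?_⟩
  conv_lhs => rw [← s.graph.tail_rot]
  conv_rhs => rw [← s.graph.tail_rot]
  have e : s.graph.rot ⟨fwd (G.facePrev d) 0 (G.width k (G.facePrev d) - (j + 1) + 1),
      Nat.zero_le _, hlt⟩ = ⟨fwd d (j + 1) 0, hj, Nat.zero_le _⟩ := by
    rw [graph_rot, ← Equiv.eq_symm_apply]
    refine Subtype.ext ?_
    rw [coe_rot_symm]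
    dsimp only
    rw [← this, cw_enter hlt]
  rw [e, tail_rot]

/-- Paths of `G` avoiding the vertex lift to the subdivided edges. A crossing on an old edge is
reached from an end of the edge other than the removed vertex, which exists as there are no loops. A
crossing of two strands is reached along its line from an old edge. -/
theorem connected_induce_base (d₀ : D)
    (hG : (G.skeleton.induce {y | y ≠ G.tail d₀}).Connected) :
    (s.graph.skeleton.induce {y | y ≠ s.graph.tail (base G k d₀)}).Connected := by
  set x₀ := s.graph.tail (base G k d₀) with hx₀
  have hb : ∀ d, s.graph.tail (base G k d) ≠ x₀ ↔ G.tail d ≠ G.tail d₀ := fun d =>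
    not_congr s.tail_base_eq_iff
  have hn : G.tail (G.inv d₀) ≠ G.tail d₀ := s.triQuad.loopless d₀
  set p := s.graph.tail (base G k (G.inv d₀)) with hp
  have hedge : ∀ d, G.tail d ≠ G.tail d₀ → ∀ (i : ℕ) (hi : i ≤ G.width k d),
      s.graph.JoinedAvoiding x₀ (s.graph.tail (base G k d))
        (s.graph.tail ⟨fwd d 0 i, Nat.zero_le _, hi⟩) := by
    intro d hd i hi
    refine s.joined_line x₀ (Nat.zero_le _) ?_ i hi
    intro i hi
    rcases Nat.eq_zero_or_pos i with rfl | h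
    · exact (hb d).mpr hd
    · exact s.fwd_succ_tail_ne_base _ (Or.inr h.ne')
  have hbase : ∀ d, G.tail d ≠ G.tail d₀ → s.graph.JoinedAvoiding x₀ p
      (s.graph.tail (base G k d)) := by
    intro d hd
    refine mem_of_induce_connected hG (Q := fun y => ∀ d, G.tail d = y →
      s.graph.JoinedAvoiding x₀ p (s.graph.tail (base G k d))) ?_ hn hd ?_ d rfl
    · intro e he1 he2 ih f hf
      rw [s.tail_base_eq_iff.mpr hf]
      refine (ih e rfl).trans ((hedge e he1 _ le_rfl).trans ?_)
      rw [← s.inv_last e]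
      refine JoinedAvoiding.edge (hedge e he1 _ le_rfl).2.1 ?_
      rw [graph_inv, s.inv_last e]
      exact (hb _).mpr he2
    · intro e he
      rw [s.tail_base_eq_iff.mpr he]
      exact JoinedAvoiding.refl ((hb _).mpr hn)
  have hside : ∀ d (i : ℕ) (hi : i < G.width k d),
      s.graph.JoinedAvoiding x₀ p (s.graph.tail ⟨fwd d 0 (i + 1), Nat.zero_le _, hi⟩) := by
    intro d i hi
    by_cases hd : G.tail d = G.tail d₀
    · rw [s.tail_edge hi]
      have hd' : G.tail (G.inv d) ≠ G.tail d₀ := by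
        rw [← hd]; exact s.triQuad.loopless d
      exact (hbase _ hd').trans (hedge _ hd' _ (by rw [s.balanced]; omega))
    · exact (hbase _ hd).trans (hedge _ hd _ hi)
  have key : ∀ x : StrandDart D, Valid G k x → ∀ hx : Valid G k x,
      s.graph.tail ⟨x, hx⟩ ≠ x₀ → s.graph.JoinedAvoiding x₀ p (s.graph.tail ⟨x, hx⟩) := by
    intro x hx
    refine Valid.vertex_cases (P := fun x => ∀ hx : Valid G k x, s.graph.tail ⟨x, hx⟩ ≠ x₀ →
      s.graph.JoinedAvoiding x₀ p (s.graph.tail ⟨x, hx⟩)) s.balanced ?_ ?_ ?_ ?_ hx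
    · intro x hx ih hx' hne
      have e : s.rot ⟨cw (G := G) (k := k) x, hx'⟩ = ⟨x, hx⟩ := by
        rw [← Equiv.eq_symm_apply]; rfl
      have e2 := s.graph.tail_rot ⟨cw (G := G) (k := k) x, hx'⟩
      rw [graph_rot, e] at e2
      rw [← e2] at hne ⊢
      exact ih hx hne
    · intro d hx hne
      exact hbase d ((hb d).mp hne)
    · intro d i hi hx _
      exact hside d i hi
    · intro d j i hj hi hx _
      have hi' : i + 1 ≤ G.width k d := hx.2
      refine JoinedAvoiding.trans ?_ (s.joined_line x₀ (j := j + 1) hj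
        (fun i hi => s.fwd_succ_tail_ne_base _ (Or.inl (Nat.succ_ne_zero j))) (i + 1) hi')
      obtain ⟨e, i', hi', h1⟩ := s.tail_line_zero hj
      rw [h1]
      exact hside e i' hi'
  refine (SimpleGraph.connected_iff _).mpr ⟨?_, ⟨⟨p, (hb _).mpr hn⟩⟩⟩
  have hjoin : ∀ y, y ≠ x₀ → s.graph.JoinedAvoiding x₀ p y := by
    intro y hy
    obtain ⟨x, rfl⟩ := exists_tail_eq y
    exact key x.1 x.2 x.2 hy
  rintro ⟨y, hy⟩ ⟨z, hz⟩
  obtain ⟨_, _, h1⟩ := (hjoin y hy).symm.trans (hjoin z hz)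
  exact h1

theorem isHedrite (hG : G.IsTwoConnected) (d₀ : D) : s.graph.IsHedrite 8 := by
  refine s.isTriQuad.isHedrite (base G k d₀) ?_
  intro x
  obtain ⟨y, rfl⟩ := exists_tail_eq x
  by_cases hy : ∃ d, s.graph.tail y = s.graph.tail (base G k d)
  · obtain ⟨d, hd⟩ := hy
    rw [hd]
    exact s.connected_induce_base d (hG.2.2 _)
  · push Not at hy
    exact connected_induce_of_faces s.isTriQuad fun z hz => s.opposite hy hz

end Strands

/-! ### Weights, their parts, and indecomposable weights -/

/-- In a graph without rail-roads, every row of 4-gons ends at a 3-gon. -/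
theorem IsTriQuad.exists_across_pow (h : G.IsTriQuad) (hirr : G.IsIrreducible) (d : D) :
    ∃ j : ℕ, G.gonality (G.leftFace ((G.across ^ j) d)) = 3 ∧
      ∀ i < j, G.gonality (G.leftFace ((G.across ^ i) d)) = 4 := by
  classical
  have := G.finite
  have hex : ∃ j : ℕ, G.gonality (G.leftFace ((G.across ^ j) d)) = 3 := by
    by_contra! hno
    refine hirr ⟨d, fun e he => ?_⟩
    obtain ⟨j, rfl⟩ := he.exists_nat_pow_eq
    exact (h.face _).resolve_left (hno j)
  exact ⟨Nat.find hex, Nat.find_spec hex, fun i hi =>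
    (h.face _).resolve_left (Nat.find_min hex hi)⟩

/-- A function on darts that does not depend on the direction and agrees on opposite edges
of 4-gons is constant along rows of 4-gons. -/
theorem across_pow_eq {n : D → ℕ} (hinv : ∀ d, n (G.inv d) = n d)
    (hquad : ∀ d, G.gonality (G.leftFace d) = 4 → n (G.faceNext (G.faceNext d)) = n d)
    {d : D} {j : ℕ} (hj : ∀ i < j, G.gonality (G.leftFace ((G.across ^ i) d)) = 4) :
    n ((G.across ^ j) d) = n d := by
  induction j with
  | zero => rfl
  | succ j ih =>
    rw [pow_succ', Perm.mul_apply, across_apply, hinv, hquad _ (hj j (Nat.lt_succ_self j)),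
      ih fun i hi => hj i (by omega)]

variable (G) in
/-- The numbers of crossings of the edges by a family of strands. -/
def IsWeight (n : D → ℕ) : Prop := (∀ d, n (G.inv d) = n d) ∧ ∃ k, n = G.width k

/-- Only 3-gons impose conditions: in a 4-gon any common number of crossings on two opposite edges
is realised by strands joining these edges. -/
theorem IsWeight.of_triangles (h : G.IsTriQuad) {n κ : D → ℕ} (hinv : ∀ d, n (G.inv d) = n d)
    (hquad : ∀ d, G.gonality (G.leftFace d) = 4 → n (G.faceNext (G.faceNext d)) = n d)
    (htri : ∀ d, G.gonality (G.leftFace d) = 3 → n d = G.width κ d) : G.IsWeight n := by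
  classical
  have := G.finite
  -- An arbitrary order on the darts decides beside which one of two opposite sides of a 4-gon all
  -- the strands are placed.
  obtain ⟨N, ⟨e⟩⟩ := Finite.exists_equiv_fin D
  refine ⟨hinv, fun d => if G.gonality (G.leftFace d) = 3 then κ d else
    if e d < e (G.faceNext (G.faceNext d)) then n (G.faceNext d) else 0, ?_⟩
  funext d
  rw [width]
  simp only [leftFace_faceNext, leftFace_facePrev, faceNext_facePrev]
  rcases h.face d with h3 | h4
  · simp only [h3, if_true]
    exact htri d h3
  · have h4' := h4
    have e1 : G.facePrev d = G.faceNext (G.faceNext (G.faceNext d)) := by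
      conv_lhs => rw [← IsTriQuad.faceNext_four h4, facePrev_faceNext]
    have hne : e (G.faceNext d) ≠ e (G.facePrev d) := by
      intro h1
      have h2 := e.injective h1
      rw [e1] at h2
      exact h.faceNext_faceNext_ne _ h2.symm
    rw [hquad d h4, ← e1]
    simp only [h4, show ¬ (4 = 3) by decide, if_false]
    rcases lt_or_gt_of_ne hne with hlt | hlt
    · rw [if_pos hlt, if_neg hlt.not_gt]
      omega
    · rw [if_neg hlt.not_gt, if_pos hlt]
      omega

theorem width_faceNext_faceNext {d : D} (h4 : G.gonality (G.leftFace d) = 4) :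
    G.width k (G.faceNext (G.faceNext d)) = G.width k d := by
  have e1 : G.facePrev d = G.faceNext (G.faceNext (G.faceNext d)) := by
    conv_lhs => rw [← IsTriQuad.faceNext_four h4, facePrev_faceNext]
  rw [width, width, facePrev_faceNext, e1, add_comm]

variable (G k) in
/-- Crossing numbers of a part of a family of strands. -/
structure IsPart (n : D → ℕ) : Prop where
  inv : ∀ d, n (G.inv d) = n d
  quad : ∀ d, G.gonality (G.leftFace d) = 4 → n (G.faceNext (G.faceNext d)) = n d
  tri : ∃ κ : D → ℕ, (∀ d, κ d ≤ k d) ∧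
    ∀ d, G.gonality (G.leftFace d) = 3 → n d = G.width κ d

namespace IsPart

variable {n : D → ℕ}

theorem isWeight (hn : G.IsPart k n) (h : G.IsTriQuad) : G.IsWeight n := by
  obtain ⟨κ, -, hκ⟩ := hn.tri
  exact .of_triangles h hn.inv hn.quad hκ

/-- Both numbers are constant along the row of 4-gons starting at `d`. By irreducibility the row
ends at a 3-gon, where `κ ≤ k` gives the inequality. -/
theorem le_width (hn : G.IsPart k n) (h : G.IsTriQuad) (hirr : G.IsIrreducible)
    (hk : G.Balanced k) (d : D) : n d ≤ G.width k d := by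
  obtain ⟨j, hj3, hj4⟩ := h.exists_across_pow hirr d
  obtain ⟨κ, hκk, hκ⟩ := hn.tri
  rw [← across_pow_eq hn.inv hn.quad hj4,
    ← across_pow_eq (n := G.width k) hk (fun d => width_faceNext_faceNext) hj4, hκ _ hj3]
  exact Nat.add_le_add (hκk _) (hκk _)

/-- On 3-gons the complement is realised by `k - κ`; the truncated subtraction is exact there
because `κ ≤ k`. -/
theorem isWeight_sub (hn : G.IsPart k n) (h : G.IsTriQuad) (hk : G.Balanced k) :
    G.IsWeight (G.width k - n) := by
  obtain ⟨κ, hκk, hκ⟩ := hn.tri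
  refine .of_triangles (κ := k - κ) h (fun d => ?_) (fun d hd => ?_) fun d hd => ?_
  · simp only [Pi.sub_apply, hn.inv, hk d]
  · simp only [Pi.sub_apply, hn.quad d hd, width_faceNext_faceNext hd]
  · have := hκk (G.faceNext d)
    have := hκk (G.facePrev d)
    simp only [Pi.sub_apply, hκ d hd, width]
    omega

/-- Counting marked positions on the edges gives a part of a family of strands, if the marks are
compatible with the strands. Here the positions are those of the strands (`ε = 0`) or
those of the gaps between them (`ε = 1`). -/
theorem of_marks (hk : G.Balanced k) {ε : ℕ} (hε : ε ≤ 1) {L : D → ℕ → Prop}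
    [∀ d, DecidablePred (L d)]
    (hinv : ∀ d i, i < G.width k d + ε → (L d i ↔ L (G.inv d) (G.width k d + ε - 1 - i)))
    (hcorner : ∀ d i, i < k (G.facePrev d) → (L d i ↔ L (G.facePrev (G.facePrev d))
      (G.width k (G.facePrev (G.facePrev d)) + ε - 1 - i)))
    (htri : ∀ d, G.gonality (G.leftFace d) = 3 → ε = 1 → ¬ L d (k (G.facePrev d)))
    (hquad : ∀ d, G.gonality (G.leftFace d) = 4 → ε = 1 →
      (L d (k (G.facePrev d)) ↔ L (G.faceNext (G.faceNext d)) (k (G.faceNext d)))) :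
    G.IsPart k (fun d => ∑ i ∈ Finset.range (G.width k d + ε), if L d i then 1 else 0) := by
  have hcorner' : ∀ d i, i < k (G.faceNext d) →
      (L d (G.width k d + ε - 1 - i) ↔ L (G.faceNext (G.faceNext d)) i) := by
    intro d i hi
    have := hcorner (G.faceNext (G.faceNext d)) i (by rwa [facePrev_faceNext])
    rw [facePrev_faceNext, facePrev_faceNext] at this
    exact this.symm
  -- The positions `j < k d` on `faceNext d` are those of the strands, or strips, that run alongside
  -- `d`.
  refine ⟨fun d => ?_, fun d hd => ?_, fun d => ∑ j ∈ Finset.range (k d),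
    if L (G.faceNext d) j then 1 else 0, fun d => ?_, fun d hd => ?_⟩
  · rw [hk d, ← Finset.sum_range_reflect]
    refine Finset.sum_congr rfl fun i hi => ?_
    exact if_congr (hinv d i (Finset.mem_range.mp hi)).symm rfl rfl
  · rw [width_faceNext_faceNext hd, ← Finset.sum_range_reflect]
    refine Finset.sum_congr rfl fun i hi => ?_
    have hi := Finset.mem_range.mp hi
    refine if_congr ?_ rfl rfl
    rw [width] at hi
    rcases lt_trichotomy i (k (G.facePrev d)) with h1 | h1 | h1
    · rw [hcorner d i h1, IsTriQuad.facePrev_four hd, width_faceNext_faceNext hd]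
    · rcases Nat.eq_zero_or_pos ε with h0 | h0
      · subst h0
        have e := hcorner' d (G.width k d + 0 - 1 - i) (by rw [width]; omega)
        rw [← e]
        rw [show G.width k d + 0 - 1 - (G.width k d + 0 - 1 - i) = i by rw [width]; omega]
      · have hε1 : ε = 1 := by omega
        subst hε1 h1
        rw [hquad d hd rfl,
          show G.width k d + 1 - 1 - k (G.facePrev d) = k (G.faceNext d) by rw [width]; omega]
    · have e := hcorner' d (G.width k d + ε - 1 - i) (by rw [width]; omega)
      rw [← e]
      rw [show G.width k d + ε - 1 - (G.width k d + ε - 1 - i) = i by rw [width]; omega]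
  · refine (Finset.sum_le_card_nsmul _ _ 1 fun j _ => ?_).trans (by simp)
    split_ifs <;> simp
  · have e0 : G.width k d + ε = k (G.facePrev d) + (ε + k (G.faceNext d)) := by
      rw [width]; omega
    have e1 : ∑ i ∈ Finset.range (G.width k d + ε), (if L d i then 1 else 0) =
        ∑ i ∈ Finset.range (k (G.facePrev d)), (if L d i then 1 else 0) +
        ∑ i ∈ Finset.range (k (G.faceNext d)),
          if L d (k (G.facePrev d) + (ε + i)) then 1 else 0 := by
      rw [e0, Finset.sum_range_add, Finset.sum_range_add]
      congr 1
      simp only [Nat.add_eq_right]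
      -- For `ε = 1` this is the middle gap, which `htri` leaves unmarked; for `ε = 0` the sum is
      -- empty.
      rw [Finset.sum_eq_zero]
      intro i hi
      have hi := Finset.mem_range.mp hi
      rw [if_neg]
      have := htri d hd (by omega)
      rwa [show i = 0 by omega]
    rw [e1, ← Finset.sum_range_reflect _ (k (G.faceNext d))]
    change _ = _ + _
    dsimp only
    rw [add_comm, faceNext_facePrev]
    congr 1
    refine Finset.sum_congr rfl fun i hi => ?_
    have hi := Finset.mem_range.mp hi
    refine if_congr ?_ rfl rfl
    rw [← hcorner' d i hi, e0, show k (G.facePrev d) + (ε + (k (G.faceNext d) - 1 - i)) =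
      k (G.facePrev d) + (ε + k (G.faceNext d)) - 1 - i by omega]

end IsPart

variable (G) in
/-- Crossing numbers of a family of strands parallel to central circuits. -/
def IsShadow (n : D → ℕ) : Prop := ∃ h : D → ℕ, (∀ d, h (G.straight d) = h d) ∧ n = G.width h

theorem IsShadow.add {n n' : D → ℕ} (h : G.IsShadow n) (h' : G.IsShadow n') :
    G.IsShadow (n + n') := by
  obtain ⟨f, hf, rfl⟩ := h
  obtain ⟨f', hf', rfl⟩ := h'
  refine ⟨f + f', fun d => by simp [hf, hf'], ?_⟩
  funext d
  simp only [Pi.add_apply, width]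
  omega

variable (G k) in
/-- A single strand that is not parallel to a central circuit. -/
structure IsIndecomposable : Prop where
  balanced : G.Balanced k
  not_shadow : ¬ G.IsShadow (G.width k)
  eq_zero_or : ∀ n, G.IsPart k n → n = 0 ∨ n = G.width k

/-- Take a weight that is not a shadow with the least total. A proper nonzero part and its
complement are weights of smaller total, hence shadows, and shadows are closed under addition. -/
theorem exists_isIndecomposable (h : G.IsTriQuad) (hirr : G.IsIrreducible) {n : D → ℕ}
    (hn : G.IsWeight n) (hs : ¬ G.IsShadow n) : ∃ k, G.IsIndecomposable k := by
  classical
  have := G.finite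
  have := Fintype.ofFinite D
  have hex : ∃ m : ℕ, ∃ n : D → ℕ, (G.IsWeight n ∧ ¬ G.IsShadow n) ∧ ∑ d, n d = m :=
    ⟨_, n, ⟨hn, hs⟩, rfl⟩
  obtain ⟨n, ⟨hn, hs⟩, hm⟩ := Nat.find_spec hex
  have hmin : ∀ n', G.IsWeight n' → ∑ d, n' d < ∑ d, n d → G.IsShadow n' := by
    intro n' hn' hlt
    by_contra hs'
    exact Nat.find_min hex (hm ▸ hlt) ⟨n', ⟨hn', hs'⟩, rfl⟩
  obtain ⟨hninv, k, rfl⟩ := hn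
  refine ⟨k, hninv, hs, fun n hp => ?_⟩
  by_contra! hne
  have hle := hp.le_width h hirr hninv
  have hsum : n + (G.width k - n) = G.width k := by
    funext d
    have := hle d
    simp only [Pi.add_apply, Pi.sub_apply]
    omega
  have hsum' : ∑ d, n d + ∑ d, (G.width k - n) d = ∑ d, G.width k d := by
    rw [← Finset.sum_add_distrib]
    exact Finset.sum_congr rfl fun d _ => congrFun hsum d
  have hpos : ∀ f : D → ℕ, f ≠ 0 → 0 < ∑ d, f d := by
    intro f hf
    obtain ⟨d, hd⟩ := Function.ne_iff.mp hf
    exact lt_of_lt_of_le (Nat.pos_of_ne_zero hd)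
      (Finset.single_le_sum (f := f) (fun _ _ => Nat.zero_le _) (Finset.mem_univ d))
  have h1 := hpos _ hne.1
  have h2 := hpos (G.width k - n) (fun h0 => hne.2 (by rw [← hsum, h0, add_zero]))
  refine hs ?_
  rw [← hsum]
  exact (hmin _ (hp.isWeight h) (by omega)).add (hmin _ (hp.isWeight_sub h hninv) (by omega))

/-! ### Deleting the strands, and their union as one central circuit -/

namespace Strands

variable (s : G.Strands k)

/-- The darts on the original edges. -/
def Old (x : StrandDarts G k) : Prop := ∃ d i, (x : StrandDart D) = fwd d 0 i

theorem Old.straight {x : StrandDarts G k} (hx : Old x) : Old (s.straight x) := by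
  obtain ⟨d, i, hx⟩ := hx
  obtain ⟨x, hv⟩ := x
  dsimp only at hx
  subst hx
  rcases Nat.lt_or_ge i (G.width k d) with h | h
  · exact ⟨d, i + 1, congrArg Subtype.val (s.straight_fwd (Nat.zero_le _) h)⟩
  · obtain rfl : i = G.width k d := le_antisymm hv.2 h
    exact ⟨_, 0, congrArg Subtype.val (s.straight_last d)⟩

theorem Old.inv {x : StrandDarts G k} (hx : Old x) : Old (s.inv x) := by
  obtain ⟨d, i, hx⟩ := hx
  exact ⟨G.inv d, G.width k d - i, by rw [coe_inv, hx]; rfl⟩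

theorem old_base (d : D) : Old (base G k d) := ⟨d, 0, rfl⟩

theorem not_old_enter {d : D} {i : ℕ} (hi : i < G.width k d) :
    ¬ Old (⟨enter G k d i, enter_valid hi.le⟩ : StrandDarts G k) := by
  rintro ⟨e, i', h⟩
  dsimp only at h
  rcases Nat.lt_or_ge i (k (G.facePrev d)) with h1 | h1
  · rw [enter_of_lt h1] at h
    cases h
  · rw [enter_of_le h1] at h
    injection h
    omega

theorem rot_edge {d : D} {i : ℕ} (hi : i < G.width k d) :
    s.rot ⟨fwd d 0 (i + 1), Nat.zero_le _, hi⟩ = ⟨enter G k d i, enter_valid hi.le⟩ := by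
  rw [← Equiv.eq_symm_apply]
  exact Subtype.ext (cw_enter hi).symm

theorem straight_pow_base (d : D) (i : ℕ) (hi : i ≤ G.width k d) :
    (s.straight ^ i) (base G k d) = ⟨fwd d 0 i, Nat.zero_le _, hi⟩ :=
  s.straight_pow (Nat.zero_le _) i hi

/-- Deleting the strands gives back the original graph. -/
theorem isDeletion : IsDeletion s.graph {x | ¬ Old x} G (base G k) where
  injective d e h := by
    have := congrArg Subtype.val h
    injection this
  mem_range x := by
    constructor
    · rintro ⟨d, rfl⟩
      refine ⟨fun h => h (old_base d), fun h => h ?_⟩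
      rw [graph_rot, s.rot_base]
      exact old_base _
    · rintro ⟨h1, h2⟩
      simp only [Set.mem_ofPred_eq, not_not] at h1 h2
      obtain ⟨d, i, hx⟩ := h1
      obtain ⟨x, hv⟩ := x
      dsimp only at hx
      subst hx
      cases i with
      | zero => exact ⟨d, rfl⟩
      -- After the first piece the tail is a crossing, and the next dart around it lies on a strand.
      | succ i =>
        refine absurd h2 ?_
        rw [graph_rot, s.rot_edge hv.2]
        exact not_old_enter hv.2
  map_rot d := (s.rot_base d).symm
  map_inv d := by
    refine ⟨G.width k d, ?_, fun j hj => ?_⟩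
    · rw [graph_straight, s.straight_pow_base d _ le_rfl]
      exact (s.inv_last d).symm
    · rw [graph_straight, s.straight_pow_base d _ hj.le]
      rintro ⟨e, he⟩
      have := congrArg Subtype.val he
      rw [coe_base, graph_inv, coe_inv] at this
      change _ = fwd _ 0 _ at this
      injection this
      omega
  meets x hx := by
    simp only [Set.mem_ofPred_eq, not_not] at hx
    obtain ⟨d, i, hx⟩ := hx
    obtain ⟨x, hv⟩ := x
    dsimp only at hx
    subst hx
    have hi : i ≤ G.width k d := hv.2
    refine ⟨G.width k d - i + 1, G.straight d, ?_⟩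
    have h1 : (s.straight ^ (G.width k d - i)) ⟨fwd d 0 i, hv⟩ =
        ⟨fwd d 0 (G.width k d), Nat.zero_le _, le_rfl⟩ := by
      rw [← s.straight_pow_base d _ le_rfl, ← s.straight_pow_base d i hi, ← Perm.mul_apply,
        ← pow_add, Nat.sub_add_cancel hi]
    rw [graph_straight, pow_succ', Perm.mul_apply, h1, s.straight_last]

/-- The central circuit through a dart. -/
def circuit (x : StrandDarts G k) : Set (StrandDarts G k) :=
  {e | s.straight.SameCycle x e ∨ s.straight.SameCycle x (s.inv e)}

/-- Reversal conjugates `straight` to its inverse, so a circuit together with its reversed darts is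
closed under `straight`. -/
theorem straight_inv_straight (x : StrandDarts G k) :
    s.straight (s.inv (s.straight x)) = s.inv x := by
  change s.rot (s.rot (s.inv (s.inv (s.rot (s.rot (s.inv x)))))) = _
  rw [s.inv_inv, s.rot_four]

variable {s}

theorem mem_circuit_inv {x e : StrandDarts G k} : s.inv e ∈ s.circuit x ↔ e ∈ s.circuit x := by
  rw [circuit, Set.mem_ofPred_eq, Set.mem_ofPred_eq, s.inv_inv, or_comm]

theorem mem_circuit_straight {x e : StrandDarts G k} :
    s.straight e ∈ s.circuit x ↔ e ∈ s.circuit x := by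
  rw [circuit, Set.mem_ofPred_eq, Set.mem_ofPred_eq, Perm.sameCycle_apply_right,
    ← s.straight_inv_straight e, Perm.sameCycle_apply_right]

theorem mem_circuit_straight_pow {x e : StrandDarts G k} (n : ℕ) :
    (s.straight ^ n) e ∈ s.circuit x ↔ e ∈ s.circuit x := by
  induction n with
  | zero => rfl
  | succ n ih => rw [pow_succ', Perm.mul_apply, mem_circuit_straight, ih]

theorem mem_circuit_rot_rot {x e : StrandDarts G k} :
    s.rot (s.rot e) ∈ s.circuit x ↔ e ∈ s.circuit x := by
  have h : s.rot (s.rot e) = s.straight (s.inv e) := by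
    change _ = s.rot (s.rot (s.inv (s.inv e)))
    rw [s.inv_inv]
  rw [h, mem_circuit_straight, mem_circuit_inv]

theorem mem_circuit_fwd {x : StrandDarts G k} {d : D} {j i : ℕ} (hj : j ≤ k d)
    (hi : i ≤ G.width k d) :
    (⟨fwd d j i, hj, hi⟩ : StrandDarts G k) ∈ s.circuit x ↔ ⟨fwd d j 0, hj, Nat.zero_le _⟩ ∈ s.circuit x := by
  rw [← s.straight_pow hj i hi, mem_circuit_straight_pow]

variable (s)

theorem not_old_of_mem_circuit {x e : StrandDarts G k} (hx : ¬ Old x) (he : e ∈ s.circuit x) :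
    ¬ Old e := by
  have := finite_strandDarts (G := G) (k := k)
  have key : ∀ y, s.straight.SameCycle x y → ¬ Old y := fun y hy ho =>
    hx (hy.symm.mem_of_forall (S := Old) (fun z hz => hz.straight s) ho)
  rcases he with he | he
  · exact key _ he
  · exact fun ho => key _ he (ho.inv s)

/-- The crossing numbers of the central circuit through `x`. -/
theorem isPart_circuit (x : StrandDarts G k) [∀ d, DecidablePred fun i =>
      ∃ hi : i ≤ G.width k d, ⟨enter G k d i, enter_valid hi⟩ ∈ s.circuit x] :
    G.IsPart k (fun d => ∑ i ∈ Finset.range (G.width k d + 0),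
      if ∃ hi : i ≤ G.width k d, ⟨enter G k d i, enter_valid hi⟩ ∈ s.circuit x then 1 else 0) := by
  refine IsPart.of_marks s.balanced (Nat.zero_le 1) (L := fun d i =>
    ∃ hi : i ≤ G.width k d, ⟨enter G k d i, enter_valid hi⟩ ∈ s.circuit x) ?_ ?_ (by simp)
    (by simp)
  · intro d i hi
    rw [add_zero] at hi
    have hi' : G.width k d + 0 - 1 - i ≤ G.width k (G.inv d) := by rw [s.balanced]; omega
    rw [exists_prop_of_true hi.le, exists_prop_of_true hi', ← mem_circuit_rot_rot]
    have e : s.rot (s.rot ⟨enter G k d i, enter_valid hi.le⟩) =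
        ⟨enter G k (G.inv d) (G.width k d + 0 - 1 - i), enter_valid hi'⟩ := by
      rw [s.rot_rot]
      refine Subtype.ext ?_
      rw [coe_rot_symm, coe_rot_symm]
      dsimp only
      rw [cw_enter hi, cw_edge]
      congr 1; omega
    rw [e]
  · intro d i hi
    have h1 := width_facePrev (G := G) (k := k) d
    have h2 := width_facePrev (G := G) (k := k) (G.facePrev d)
    have h3 := width_eq (G := G) (k := k) d
    have h4 := width_eq (G := G) (k := k) (G.facePrev (G.facePrev d))
    rw [faceNext_facePrev] at h4
    have hi1 : i ≤ G.width k d := by omega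
    have hi2 : G.width k (G.facePrev (G.facePrev d)) + 0 - 1 - i ≤
      G.width k (G.facePrev (G.facePrev d)) := by omega
    rw [exists_prop_of_true hi1, exists_prop_of_true hi2, ← mem_circuit_inv]
    have e1 : s.inv ⟨enter G k d i, enter_valid hi1⟩ =
        ⟨fwd (G.facePrev d) (i + 1) (G.width k (G.facePrev d)), hi, le_rfl⟩ := by
      refine Subtype.ext ?_
      rw [coe_inv]
      dsimp only
      rw [enter_of_lt hi]
      rfl
    have e2 : (⟨enter G k (G.facePrev (G.facePrev d))
        (G.width k (G.facePrev (G.facePrev d)) + 0 - 1 - i), enter_valid hi2⟩ : StrandDarts G k) =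
        ⟨fwd (G.facePrev d) (i + 1) 0, hi, Nat.zero_le _⟩ := by
      refine Subtype.ext ?_
      dsimp only
      rw [enter_of_le (by omega), faceNext_facePrev]
      congr 1; omega
    rw [e1, e2, mem_circuit_fwd hi le_rfl]

/-- An indecomposable family of strands is a single central circuit. -/
theorem isCentralCircuit (hk : G.IsIndecomposable k) : s.graph.IsCentralCircuit {x | ¬ Old x} := by
  classical
  obtain ⟨d₀, hd₀⟩ : ∃ d, 0 < G.width k d := by
    by_contra! h0
    refine hk.not_shadow ⟨0, fun _ => rfl, ?_⟩
    funext d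
    have := h0 d
    change _ = 0 + 0
    omega
  set x : StrandDarts G k := ⟨enter G k d₀ 0, enter_valid hd₀.le⟩ with hx
  have hxo : ¬ Old x := not_old_enter hd₀
  have hall : ∀ d i (hi : i < G.width k d),
      ⟨enter G k d i, enter_valid hi.le⟩ ∈ s.circuit x := by
    -- The circuit through `x` is a part and is nonzero at `d₀`, so it accounts for all crossings on
    -- all edges.
    rcases hk.eq_zero_or _ (s.isPart_circuit x) with h | h
    · have := congrFun h d₀
      rw [Pi.zero_apply, Finset.sum_eq_zero_iff] at this
      have := this 0 (Finset.mem_range.mpr (by omega))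
      rw [if_pos ⟨hd₀.le, Or.inl (Perm.SameCycle.refl _ _)⟩] at this
      omega
    · intro d i hi
      by_contra hno
      have := congrFun h d
      have hlt : ∑ i ∈ Finset.range (G.width k d + 0), (if ∃ hi : i ≤ G.width k d,
          ⟨enter G k d i, enter_valid hi⟩ ∈ s.circuit x then 1 else 0) <
          ∑ i ∈ Finset.range (G.width k d + 0), 1 := by
        refine Finset.sum_lt_sum (fun i _ => by split_ifs <;> simp)
          ⟨i, Finset.mem_range.mpr (by omega), ?_⟩
        rw [if_neg]
        · simp
        · rintro ⟨_, h1⟩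
          exact hno h1
      simp only [Finset.sum_const, Finset.card_range, smul_eq_mul, mul_one] at hlt
      omega
  -- Every strand line starts at an old edge, where the preceding claim applies.
  have hfwd : ∀ d j i (hj : j + 1 ≤ k d) (hi : i ≤ G.width k d),
      ⟨fwd d (j + 1) i, hj, hi⟩ ∈ s.circuit x := by
    intro d j i hj hi
    have h1 := width_facePrev (G := G) (k := k) d
    have hlt : G.width k (G.facePrev d) - (j + 1) < G.width k (G.facePrev d) := by omega
    have h2 := hall (G.facePrev d) (G.width k (G.facePrev d) - (j + 1)) hlt
    rw [mem_circuit_fwd hj hi]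
    have e : (⟨fwd d (j + 1) 0, hj, Nat.zero_le _⟩ : StrandDarts G k) =
        ⟨enter G k (G.facePrev d) (G.width k (G.facePrev d) - (j + 1)), enter_valid hlt.le⟩ := by
      refine Subtype.ext ?_
      dsimp only
      rw [enter_of_le (by omega), faceNext_facePrev]
      congr 1; omega
    rw [e]
    exact h2
  refine ⟨x, ?_⟩
  change _ = s.circuit x
  ext y
  refine ⟨fun hy => ?_, s.not_old_of_mem_circuit hxo⟩
  obtain ⟨y, hv⟩ := y
  cases y with
  | fwd d j i =>
    cases j with
    | zero => exact absurd ⟨d, i, rfl⟩ hy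
    | succ j => exact hfwd d j i hv.1 hv.2
  | bwd d j i =>
    rw [← mem_circuit_inv]
    exact hfwd d j i hv.1 hv.2

end Strands

/-! ### Absence of rail-roads in the new graph -/

variable (G) in
/-- The dart `d` crosses into a rail-road. -/
def IsRail (d : D) : Prop := ∀ e, G.across.SameCycle d e → G.gonality (G.leftFace e) = 4

theorem IsRail.of_sameCycle {d e : D} (hd : G.IsRail d) (h : G.across.SameCycle d e) :
    G.IsRail e := fun _ hf => hd _ (h.trans hf)

/-- A rail-road can be traversed in both directions. -/
theorem IsRail.inv {d : D} (hd : G.IsRail d) : G.IsRail (G.inv d) := by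
  have := G.finite
  have hface : ∀ e, G.across.SameCycle d (G.inv e) →
      G.across.SameCycle d (G.faceNext (G.faceNext e)) ∧ G.gonality (G.leftFace e) = 4 := by
    intro e he
    obtain ⟨y, hy⟩ := G.across.surjective (G.inv e)
    rw [← hy, Perm.sameCycle_apply_right] at he
    rw [across_apply, G.inv.injective.eq_iff] at hy
    have h4 := hd y he
    rw [← hy, IsTriQuad.faceNext_four h4, leftFace_faceNext, leftFace_faceNext]
    exact ⟨he, h4⟩
  intro e he
  refine (hface e (he.mem_of_forall (S := fun e => G.across.SameCycle d (G.inv e)) ?_ ?_)).2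
  · intro x hx
    rw [across_apply, inv_inv_apply]
    exact (hface x hx).1
  · rw [inv_inv_apply]

/-- An edge crossed by `n` strands has `n + 1` pieces; if the two end pieces are unmarked, at most
`n - 1` are marked. -/
theorem sum_range_add_one_le {f : ℕ → ℕ} (hf : ∀ i, f i ≤ 1) {n : ℕ} (h0 : f 0 = 0)
    (hn : f n = 0) (hpos : 0 < n) : ∑ i ∈ Finset.range (n + 1), f i + 1 ≤ n := by
  obtain ⟨m, rfl⟩ : ∃ m, n = m + 1 := ⟨n - 1, by omega⟩
  rw [Finset.sum_range_succ, hn, Finset.sum_range_succ', h0]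
  have : ∑ i ∈ Finset.range m, f (i + 1) ≤ ∑ i ∈ Finset.range m, 1 :=
    Finset.sum_le_sum fun i _ => hf _
  simp only [Finset.sum_const, Finset.card_range, smul_eq_mul, mul_one] at this
  omega

namespace Strands

variable (s : G.Strands k)

theorem across_line {d : D} {j i : ℕ} (hj : j ≤ k d) (hi : i ≤ G.width k d) :
    s.across.SameCycle ⟨fwd d 0 i, Nat.zero_le _, hi⟩ ⟨fwd d j i, hj, hi⟩ := by
  induction j with
  | zero => exact Perm.SameCycle.refl _ _
  | succ j ih =>
    rw [← s.across_fwd hj hi, Perm.sameCycle_apply_right]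
    exact ih (by omega)

theorem inv_edge {d : D} {i : ℕ} (hi : i ≤ G.width k d) :
    s.inv ⟨fwd d 0 i, Nat.zero_le _, hi⟩ =
      ⟨fwd (G.inv d) 0 (G.width k d - i), Nat.zero_le _, by rw [s.balanced]; omega⟩ := rfl

theorem across_bwd {d : D} {j i : ℕ} (hj : j < k d) (hi : i ≤ G.width k d) :
    s.across.SameCycle ⟨bwd d j i, hj, hi⟩ (s.inv ⟨fwd d 0 i, Nat.zero_le _, hi⟩) := by
  have key : ∀ j (hj : j < k d),
      s.across ⟨bwd d j i, hj, hi⟩ = s.inv ⟨fwd d j i, hj.le, hi⟩ := by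
    intro j hj
    refine Subtype.ext ?_
    rw [coe_across]
    exact congrArg (StrandDart.flip G k) (face_face_bwd hj hi)
  induction j with
  | zero =>
    rw [← key 0 hj, Perm.sameCycle_apply_right]
  | succ j ih =>
    refine Perm.SameCycle.trans ?_ (ih (by omega))
    rw [← Perm.sameCycle_apply_left, key (j + 1) hj]
    exact Perm.SameCycle.refl _ _

theorem across_inv_line {d : D} {j i : ℕ} (hj : j ≤ k d) (hi : i ≤ G.width k d) :
    s.across.SameCycle (s.inv ⟨fwd d j i, hj, hi⟩) (s.inv ⟨fwd d 0 i, Nat.zero_le _, hi⟩) := by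
  cases j with
  | zero => exact Perm.SameCycle.refl _ _
  | succ j => exact s.across_bwd hj hi

/-- A strip near the tail of `d` turns around the tail of `d`. -/
theorem across_of_lt {d : D} {i : ℕ} (hi : i < k (G.facePrev d)) (hi₁ : i ≤ G.width k d)
    (hi₂ : G.width k (G.facePrev (G.facePrev d)) - i ≤
      G.width k (G.facePrev (G.facePrev d))) :
    s.across.SameCycle ⟨fwd d 0 i, Nat.zero_le _, hi₁⟩
      (s.inv ⟨fwd (G.facePrev (G.facePrev d)) 0
        (G.width k (G.facePrev (G.facePrev d)) - i), Nat.zero_le _, hi₂⟩) := by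
  refine (s.across_line le_rfl hi₁).trans (Perm.SameCycle.trans ?_ (s.across_inv_line le_rfl hi₂))
  rw [← Perm.sameCycle_apply_left]
  refine Eq.sameCycle (Subtype.ext ?_) _
  rw [coe_across]
  exact congrArg (StrandDart.flip G k) (face_face_last_of_lt hi)

/-- The other strips turn around the head of `d` or go straight through a 4-gon. -/
theorem across_of_le {d : D} {i : ℕ} (hi : k (G.facePrev d) ≤ i) (hi₁ : i ≤ G.width k d)
    (hi₂ : G.width k d - i ≤ G.width k (G.faceNext (G.faceNext d))) :
    s.across.SameCycle ⟨fwd d 0 i, Nat.zero_le _, hi₁⟩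
      (s.inv ⟨fwd (G.faceNext (G.faceNext d)) 0 (G.width k d - i), Nat.zero_le _, hi₂⟩) := by
  refine (s.across_line le_rfl hi₁).trans (Perm.SameCycle.trans ?_ (s.across_inv_line le_rfl hi₂))
  rw [← Perm.sameCycle_apply_left]
  refine Eq.sameCycle (Subtype.ext ?_) _
  rw [coe_across]
  exact congrArg (StrandDart.flip G k) (face_face_last_of_le hi)

/-- The middle strip of a 3-gon ends there. -/
theorem not_isRail_center {d : D} (h3 : G.gonality (G.leftFace d) = 3)
    (hi : k (G.facePrev d) ≤ G.width k d) :
    ¬ s.graph.IsRail ⟨fwd d 0 (k (G.facePrev d)), Nat.zero_le _, hi⟩ := by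
  intro h
  have h1 := h _ (s.across_line le_rfl hi)
  have h2 := s.gonality_center d
  rw [h3] at h2
  change s.graph.gonality (s.graph.leftFace ⟨center G k d, center_valid d⟩) = 4 at h1
  omega

theorem exists_edge (x : StrandDarts G k) : ∃ (d : D) (i : ℕ) (hi : i ≤ G.width k d),
    s.across.SameCycle x ⟨fwd d 0 i, Nat.zero_le _, hi⟩ := by
  match x with
  | ⟨fwd d j i, hj, hi⟩ => exact ⟨d, i, hi, (s.across_line hj hi).symm⟩
  | ⟨bwd d j i, hj, hi⟩ =>
    exact ⟨G.inv d, G.width k d - i, by rw [s.balanced]; omega, s.across_bwd hj hi⟩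

/-- No rail-road has an original central circuit on its side. -/
theorem not_isRail_base (hk : G.IsIndecomposable k) (e₀ : D) : ¬ s.graph.IsRail (base G k e₀) := by
  classical
  intro hR
  have := G.finite
  -- The darts through whose first piece the rail-road enters their left face.
  let w : Set D := {d | s.across.SameCycle (base G k e₀) (base G k d)}
  -- A rail-road that enters through the first piece of `d` next crosses an old edge at the first
  -- piece of `τ d`.
  let τ : D → D := fun d => G.inv (G.facePrev (G.facePrev d))
  have hτ : ∀ y, τ (G.faceNext (G.faceNext (G.inv y))) = y := fun y => by simp [τ]
  have hτi : Injective τ := by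
    intro d e hde
    have h1 := congrArg (fun y => G.faceNext (G.faceNext (G.inv y))) hde
    simpa [τ] using h1
  -- Without a strand alongside `facePrev d`, the first piece of `d` would be the middle one, and
  -- the middle strip ends in the 3-gon.
  have hpos : ∀ d ∈ w, G.gonality (G.leftFace d) = 3 → 0 < k (G.facePrev d) := by
    intro d hd h3
    by_contra h0
    have h0 : k (G.facePrev d) = 0 := by omega
    refine s.not_isRail_center h3 (by omega) ?_
    have e : (⟨fwd d 0 (k (G.facePrev d)), Nat.zero_le _, by omega⟩ : StrandDarts G k) =
      base G k d := Subtype.ext (congrArg (fwd d 0) h0)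
    rw [e]
    exact hR.of_sameCycle hd
  have hwτ : ∀ d ∈ w, τ d ∈ w := by
    intro d hd
    refine Perm.SameCycle.trans hd ?_
    rcases Nat.eq_zero_or_pos (k (G.facePrev d)) with h0 | h0
    · have h4 := (s.triQuad.face d).resolve_left fun h3 => (hpos d hd h3).ne' h0
      have h1 := s.across_of_le (d := d) (i := 0) h0.le (Nat.zero_le _)
        (by rw [width_faceNext_faceNext h4]; omega)
      refine h1.trans (Eq.sameCycle (Subtype.ext ?_) _)
      rw [coe_inv]
      change fwd _ 0 _ = fwd _ 0 _
      rw [width_faceNext_faceNext h4,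
        show τ d = G.inv (G.faceNext (G.faceNext d)) from congrArg G.inv (IsTriQuad.facePrev_four h4)]
      congr 1; omega
    · have h1 := s.across_of_lt (d := d) (i := 0) h0 (Nat.zero_le _) (by omega)
      refine h1.trans (Eq.sameCycle (Subtype.ext ?_) _)
      rw [coe_inv]
      change fwd _ 0 _ = fwd _ 0 _
      congr 1; omega
  -- The converse uses finiteness: an injective map of `w` into itself is onto.
  have hwτ' : ∀ d, τ d ∈ w ↔ d ∈ w := by
    intro d
    refine ⟨fun hd => ?_, hwτ d⟩
    let f : w → w := fun d => ⟨τ d, hwτ d d.2⟩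
    have hf : Injective f := fun d e hde => Subtype.ext (hτi (congrArg Subtype.val hde))
    obtain ⟨e, he⟩ := (Finite.injective_iff_surjective.mp hf) ⟨τ d, hd⟩
    rw [← hτi (congrArg Subtype.val he)]
    exact e.2
  -- Having entered through the first piece of `faceNext d`, the rail-road runs beside `d`. Thus `h`
  -- marks the sides of circuits that it follows.
  let h : D → ℕ := fun d => if G.faceNext d ∈ w then 1 else 0
  have hstraight : ∀ e, h (G.straight e) = h e := by
    intro e
    have e1 := s.triQuad.straight_facePrev_inv (G.faceNext (G.faceNext (G.inv (G.faceNext e))))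
    simp only [facePrev_faceNext, inv_inv_apply] at e1
    have e2 := hwτ' (G.faceNext (G.faceNext (G.inv (G.faceNext e))))
    rw [hτ] at e2
    simp only [h]
    rw [e1]
    exact if_congr e2.symm rfl rfl
  have hwidth : ∀ d, G.width h d = (if G.inv d ∈ w then 1 else 0) + if d ∈ w then 1 else 0 := by
    intro d
    have e2 := hwτ' (G.faceNext (G.faceNext d))
    have e3 : τ (G.faceNext (G.faceNext d)) = G.inv d := by simp [τ]
    rw [e3] at e2
    rw [width]
    simp only [h, faceNext_facePrev]
    exact congrArg (· + _) (if_congr e2.symm rfl rfl)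
  -- The formula `hwidth` is symmetric in `d` and `inv d`, and `hpos` says that `h ≤ k` on 3-gons.
  have hpart : G.IsPart k (G.width h) := by
    refine ⟨fun d => ?_, fun d hd => width_faceNext_faceNext hd,
      fun d => if G.gonality (G.leftFace d) = 3 then h d else 0, fun d => ?_, fun d hd => ?_⟩
    · rw [hwidth, hwidth, inv_inv_apply, add_comm]
    · dsimp only
      by_cases h3 : G.gonality (G.leftFace d) = 3
      · rw [if_pos h3]
        by_cases hd : G.faceNext d ∈ w
        · have := hpos _ hd (by rwa [leftFace_faceNext])
          rw [facePrev_faceNext] at this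
          simp only [h, if_pos hd]
          omega
        · simp only [h, if_neg hd]
          omega
      · rw [if_neg h3]
        omega
    · simp only [width, leftFace_faceNext, leftFace_facePrev, hd, if_true]
  -- The part is nonzero at `e₀`, and equality with `width k` would make the whole family a shadow.
  rcases hk.eq_zero_or _ hpart with h0 | h0
  · have := congrFun h0 e₀
    have he : e₀ ∈ w := Perm.SameCycle.refl _ _
    rw [hwidth, if_pos he, Pi.zero_apply] at this
    omega
  · exact hk.not_shadow ⟨h, hstraight, h0.symm⟩

/-- Adding an indecomposable family of strands does not create rail-roads. -/
theorem isIrreducible (hk : G.IsIndecomposable k) : s.graph.IsIrreducible := by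
  classical
  rintro ⟨x, hx⟩
  obtain ⟨d₀, i₀, hi₀, hx₀⟩ := s.exists_edge x
  set x₀ : StrandDarts G k := ⟨fwd d₀ 0 i₀, Nat.zero_le _, hi₀⟩ with hx₀'
  have hR : s.graph.IsRail x₀ := IsRail.of_sameCycle (G := s.graph) hx hx₀
  -- The rail-road is taken in both directions, so that the marks on an edge do not depend on the
  -- direction of its dart.
  let Q : StrandDarts G k → Prop := fun y =>
    s.across.SameCycle x₀ y ∨ s.across.SameCycle x₀ (s.inv y)
  have hQinv : ∀ y, Q (s.inv y) ↔ Q y := by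
    intro y
    simp only [Q, s.inv_inv, or_comm]
  have hQrail : ∀ y, Q y → s.graph.IsRail y := by
    rintro y (hy | hy)
    · exact hR.of_sameCycle hy
    · have := (hR.of_sameCycle hy).inv
      rwa [graph_inv, s.inv_inv] at this
  have hQ : ∀ a b, s.across.SameCycle a (s.inv b) → s.across.SameCycle b (s.inv a) →
      (Q a ↔ Q b) := by
    intro a b hab hba
    constructor
    · rintro (h | h)
      · exact Or.inr (h.trans hab)
      · exact Or.inl (h.trans hba.symm)
    · rintro (h | h)
      · exact Or.inr (h.trans hba)
      · exact Or.inl (h.trans hab.symm)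
  -- Marked are the pieces of old edges crossed by the rail-road, that is, the gaps between strands;
  -- hence `of_marks` is used with `ε = 1`.
  let L : D → ℕ → Prop := fun d i => ∃ hi : i ≤ G.width k d, Q ⟨fwd d 0 i, Nat.zero_le _, hi⟩
  have hpart := IsPart.of_marks (k := k) (L := L) s.balanced le_rfl
    (by
      intro d i hi
      have hi1 : i ≤ G.width k d := by omega
      have hi2 : G.width k d + 1 - 1 - i ≤ G.width k (G.inv d) := by rw [s.balanced]; omega
      simp only [L]
      rw [exists_prop_of_true hi1, exists_prop_of_true hi2, ← hQinv, s.inv_edge hi1]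
      rfl)
    (by
      intro d i hi
      have h1 := width_eq (G := G) (k := k) d
      have h2 := width_eq (G := G) (k := k) (G.facePrev (G.facePrev d))
      rw [faceNext_facePrev] at h2
      have hi1 : i ≤ G.width k d := by omega
      have hi2 : G.width k (G.facePrev (G.facePrev d)) + 1 - 1 - i ≤
        G.width k (G.facePrev (G.facePrev d)) := by omega
      simp only [L]
      rw [exists_prop_of_true hi1, exists_prop_of_true hi2]
      refine hQ _ _ (s.across_of_lt hi hi1 hi2) ?_
      have h3 := s.across_of_le (d := G.facePrev (G.facePrev d))
        (i := G.width k (G.facePrev (G.facePrev d)) + 1 - 1 - i) (by omega) hi2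
        (by simp only [faceNext_facePrev]; omega)
      refine h3.trans (Eq.sameCycle (congrArg s.inv (Subtype.ext ?_)) _)
      dsimp only
      simp only [faceNext_facePrev]
      congr 1; omega)
    (by
      rintro d h3 - ⟨hi, h⟩
      exact s.not_isRail_center h3 hi (hQrail _ h))
    (by
      intro d h4 _
      have h1 := width_eq (G := G) (k := k) d
      have h2 := width_faceNext_faceNext (k := k) h4
      have hp3 : G.faceNext (G.faceNext (G.faceNext d)) = G.facePrev d := by
        conv_rhs => rw [← IsTriQuad.faceNext_four h4, facePrev_faceNext]
      have hi1 : k (G.facePrev d) ≤ G.width k d := by omega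
      have hi2 : k (G.faceNext d) ≤ G.width k (G.faceNext (G.faceNext d)) := by omega
      simp only [L]
      rw [exists_prop_of_true hi1, exists_prop_of_true hi2]
      refine hQ _ _ ?_ ?_
      · have h3 := s.across_of_le (d := d) le_rfl hi1 (by omega)
        refine h3.trans (Eq.sameCycle (congrArg s.inv (Subtype.ext ?_)) _)
        dsimp only
        congr 1; omega
      · have h3 := s.across_of_le (d := G.faceNext (G.faceNext d)) (i := k (G.faceNext d))
          (by rw [facePrev_faceNext]) hi2 (by rw [IsTriQuad.faceNext_four h4]; omega)
        refine h3.trans (Eq.sameCycle (congrArg s.inv (Subtype.ext ?_)) _)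
        dsimp only
        rw [IsTriQuad.faceNext_four h4]
        congr 1; omega)
  have hL0 : ∀ d, ¬ L d 0 := by
    rintro d ⟨_, h⟩
    exact s.not_isRail_base hk d (hQrail _ h)
  have hLn : ∀ d, ¬ L d (G.width k d) := by
    rintro d ⟨_, h⟩
    refine s.not_isRail_base hk (G.inv d) (hQrail _ ?_)
    rw [← s.inv_last, hQinv]
    exact h
  have hL₀ : L d₀ i₀ := ⟨hi₀, Or.inl (Perm.SameCycle.refl _ _)⟩
  -- The end pieces on `d₀` are unmarked, so the part is strictly below `width k` there; as piece
  -- `i₀` is marked, it is not zero either.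
  have hle : ∑ i ∈ Finset.range (G.width k d₀ + 1), (if L d₀ i then 1 else 0) + 1 ≤
      G.width k d₀ := by
    refine sum_range_add_one_le (fun i => by split_ifs <;> simp) (if_neg (hL0 d₀))
      (if_neg (hLn d₀)) ?_
    rcases Nat.eq_zero_or_pos i₀ with h | h
    · rw [h] at hL₀
      exact absurd hL₀ (hL0 d₀)
    · omega
  rcases hk.eq_zero_or _ hpart with h | h
  · have := congrFun h d₀
    rw [Pi.zero_apply, Finset.sum_eq_zero_iff] at this
    have := this i₀ (Finset.mem_range.mpr (by omega))
    rw [if_pos hL₀] at this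
    omega
  · have := congrFun h d₀
    omega

end Strands

/-! ### Rows of 4-gons joining 3-gons -/

theorem inv_across (d : D) : G.inv (G.across d) = G.faceNext (G.faceNext d) := by
  rw [across_apply, inv_inv_apply]

theorem across_inv_across {d : D} (h4 : G.gonality (G.leftFace d) = 4) :
    G.across (G.inv (G.across d)) = G.inv d := by
  rw [inv_across, across_apply, IsTriQuad.faceNext_four h4]

variable (G) in
/-- The row of 4-gons which starts across the edge of `z` ends at the face to the left of `y`. -/
def IsRow (z y : D) : Prop :=
  ∃ j : ℕ, (G.across ^ j) (G.inv z) = y ∧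
    ∀ i < j, G.gonality (G.leftFace ((G.across ^ i) (G.inv z))) = 4

namespace IsRow

variable {z y : D}

theorem symm (hr : G.IsRow z y) : G.IsRow y z := by
  obtain ⟨j, rfl, hj⟩ := hr
  have key : ∀ i ≤ j, (G.across ^ i) (G.inv ((G.across ^ j) (G.inv z))) =
      G.inv ((G.across ^ (j - i)) (G.inv z)) := by
    intro i
    induction i with
    | zero => intro; rfl
    | succ i ih =>
      intro hi
      rw [pow_succ', Perm.mul_apply, ih (by omega),
        show j - i = (j - (i + 1)) + 1 by omega, pow_succ', Perm.mul_apply,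
        across_inv_across (hj _ (by omega))]
  refine ⟨j, ?_, fun i hi => ?_⟩
  · rw [key j le_rfl, Nat.sub_self, pow_zero, Perm.one_apply, inv_inv_apply]
  · rw [key i hi.le, show j - i = (j - (i + 1)) + 1 by omega, pow_succ', Perm.mul_apply,
      inv_across, leftFace_faceNext, leftFace_faceNext]
    exact hj _ (by omega)

theorem unique {y' : D} (hr : G.IsRow z y) (hr' : G.IsRow z y')
    (hy : G.gonality (G.leftFace y) = 3) (hy' : G.gonality (G.leftFace y') = 3) : y = y' := by
  obtain ⟨j, rfl, hj⟩ := hr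
  obtain ⟨j', rfl, hj'⟩ := hr'
  rcases lt_trichotomy j j' with h | rfl | h
  · have := hj' j h
    omega
  · rfl
  · have := hj j' h
    omega

theorem apply_eq {n : D → ℕ} (hr : G.IsRow z y) (hinv : ∀ d, n (G.inv d) = n d)
    (hquad : ∀ d, G.gonality (G.leftFace d) = 4 → n (G.faceNext (G.faceNext d)) = n d) :
    n y = n z := by
  obtain ⟨j, rfl, hj⟩ := hr
  rw [across_pow_eq hinv hquad hj, hinv]

/-- The rail of a row of 4-gons is a part of a central circuit. -/
theorem apply_faceNext {h : D → ℕ} (hG : G.IsTriQuad) (hr : G.IsRow z y)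
    (hh : ∀ d, h (G.straight d) = h d) : h (G.faceNext y) = h (G.facePrev z) := by
  obtain ⟨j, rfl, -⟩ := hr
  induction j with
  | zero => rw [pow_zero, Perm.one_apply, ← hh (G.facePrev z), hG.straight_facePrev]
  | succ j ih => rw [← ih, pow_succ', Perm.mul_apply, ← hG.straight_faceNext, hh]

end IsRow

variable (G) in
/-- Two 3-gons are joined by a row of 4-gons. -/
def RowAdj (F F' : G.Face) : Prop :=
  G.gonality F = 3 ∧ G.gonality F' = 3 ∧
    ∃ z y, G.leftFace z = F ∧ G.leftFace y = F' ∧ G.IsRow z y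

theorem RowAdj.symm {F F' : G.Face} : G.RowAdj F F' → G.RowAdj F' F := by
  rintro ⟨h, h', z, y, hz, hy, hr⟩
  exact ⟨h', h, y, z, hy, hz, hr.symm⟩

/-- The faces met on the left of a central circuit after `e` are reached by going from face to face
across the edges that end on that side. -/
theorem straight_pow_succ (h : G.IsTriQuad) (e : D) (j : ℕ) :
    (G.straight ^ (j + 1)) e = G.faceNext ((G.across ^ j) (G.inv (G.faceNext e))) := by
  induction j with
  | zero => rw [zero_add, pow_one, h.straight_eq]; rfl
  | succ j ih =>
    rw [pow_succ', Perm.mul_apply, ih, h.straight_faceNext, pow_succ' G.across, Perm.mul_apply]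

/-- Consecutive 3-gons on one side of a central circuit are joined by a row of 4-gons. -/
theorem leftFace_straight_pow_mem (h : G.IsTriQuad) (hirr : G.IsIrreducible) {S : Set G.Face}
    (hS : ∀ F ∈ S, ∀ F', G.RowAdj F F' → F' ∈ S) (m : ℕ) :
    ∀ e, G.gonality (G.leftFace e) = 3 → G.leftFace e ∈ S →
      G.gonality (G.leftFace ((G.straight ^ m) e)) = 3 →
      G.leftFace ((G.straight ^ m) e) ∈ S := by
  induction m using Nat.strong_induction_on with
  | _ m ih =>
    intro e he heS hm
    rcases m with - | m
    · exact heS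
    -- This finds the first 3-gon after `e` on the left of the circuit; it does not come after the
    -- target, and induction covers the rest.
    obtain ⟨j, hj3, hj4⟩ := h.exists_across_pow hirr (G.inv (G.faceNext e))
    have hjm : j ≤ m := by
      by_contra! hlt
      rw [straight_pow_succ h, leftFace_faceNext] at hm
      have := hj4 m hlt
      omega
    have hmem : G.leftFace ((G.straight ^ (j + 1)) e) ∈ S := by
      rw [straight_pow_succ h, leftFace_faceNext]
      exact hS _ heS _ ⟨he, hj3, G.faceNext e, _, leftFace_faceNext G _, rfl, j, rfl, hj4⟩
    have e1 : (G.straight ^ (m + 1)) e = (G.straight ^ (m - j)) ((G.straight ^ (j + 1)) e) := by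
      rw [← Perm.mul_apply, ← pow_add]
      congr 2; omega
    rw [e1] at hm ⊢
    refine ih _ (by omega) _ ?_ hmem hm
    rwa [straight_pow_succ h, leftFace_faceNext]

/-- A 3-gon joined by rows of 4-gons to two other 3-gons. -/
theorem exists_rowAdj (h : G.IsTriQuad) (hirr : G.IsIrreducible) {d : D}
    (hd : 3 ≤ (G.threeGonsLeftOf d).ncard) :
    ∃ F F₁ F₂, G.RowAdj F F₁ ∧ G.RowAdj F F₂ ∧ F₁ ≠ F ∧ F₂ ≠ F ∧ F₁ ≠ F₂ := by
  have := G.finite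
  obtain ⟨F, hF3, e, hde, heF⟩ : (G.threeGonsLeftOf d).Nonempty :=
    Set.nonempty_of_ncard_ne_zero (by omega)
  by_contra! hno
  -- A set containing `F` and closed under row adjacency contains all the given 3-gons, so it has at
  -- least three elements.
  have key : ∀ S : Set G.Face, F ∈ S → (∀ F ∈ S, ∀ F', G.RowAdj F F' → F' ∈ S) →
      G.threeGonsLeftOf d ⊆ S := by
    rintro S hFS hS _ ⟨h3, e', hde', rfl⟩
    obtain ⟨m, rfl⟩ := (hde.symm.trans hde').exists_nat_pow_eq
    exact leftFace_straight_pow_mem h hirr hS m e (by rwa [heF]) (by rwa [heF]) h3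
  have hcard : ∀ F' : G.Face, ({F, F'} : Set G.Face).ncard ≤ 2 := fun F' =>
    (Set.ncard_insert_le _ _).trans (by rw [Set.ncard_singleton])
  by_cases hadj : ∃ F', G.RowAdj F F' ∧ F' ≠ F
  -- If no 3-gon has two distinct neighbours other than itself, then `{F, F'}` is closed, which is
  -- too small.
  · obtain ⟨F', hFF', hne⟩ := hadj
    have hsub := key {F, F'} (by simp) (by
      rintro X (rfl | rfl) Y hXY
      · by_cases hY : Y = X
        · exact Or.inl hY
        · exact Or.inr (hno _ _ _ hXY hFF' hY hne)
      · by_cases hY : Y = X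
        · exact Or.inr hY
        · exact Or.inl (hno _ _ _ hXY hFF'.symm hY hne.symm))
    have := Set.ncard_le_ncard hsub (Set.toFinite _)
    have := hcard F'
    omega
  · push Not at hadj
    have hsub := key {F, F} (by simp) (by
      rintro X hX Y hXY
      have hX : X = F := by simpa using hX
      subst hX
      simpa using hadj Y hXY)
    have := Set.ncard_le_ncard hsub (Set.toFinite _)
    have := hcard F
    omega

/-! ### A weight that is not a shadow -/

theorem faceNext_faceNext_three {d : D} (h3 : G.gonality (G.leftFace d) = 3) :
    G.faceNext (G.faceNext d) = G.facePrev d := by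
  conv_rhs => rw [← IsTriQuad.faceNext_three h3, facePrev_faceNext]

theorem eq_or_eq_of_leftFace_eq {d e : D} (h3 : G.gonality (G.leftFace d) = 3)
    (he : G.leftFace e = G.leftFace d) :
    e = d ∨ e = G.faceNext d ∨ e = G.facePrev d := by
  have := G.finite
  have hcyc := ((leftFace_eq_iff G).mp he).symm
  refine hcyc.mem_of_forall (S := fun e => e = d ∨ e = G.faceNext d ∨ e = G.facePrev d) ?_
    (Or.inl rfl)
  rintro x (rfl | rfl | rfl)
  · exact Or.inr (Or.inl rfl)
  · refine Or.inr (Or.inr ?_)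
    exact faceNext_faceNext_three h3
  · exact Or.inl (faceNext_facePrev G _)

variable (G) in
/-- The edges of a row of 4-gons. -/
def rowEdges (z : D) (j : ℕ) : Set D :=
  {x | ∃ i ≤ j, x = (G.across ^ i) (G.inv z) ∨ x = G.inv ((G.across ^ i) (G.inv z))}

section rowEdges

variable {z : D} {j : ℕ}

theorem inv_mem_rowEdges {x : D} (hx : x ∈ G.rowEdges z j) : G.inv x ∈ G.rowEdges z j := by
  obtain ⟨i, hi, rfl | rfl⟩ := hx
  · exact ⟨i, hi, Or.inr rfl⟩
  · exact ⟨i, hi, Or.inl (inv_inv_apply G _)⟩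

theorem self_mem_rowEdges : z ∈ G.rowEdges z j :=
  ⟨0, Nat.zero_le _, Or.inr (inv_inv_apply G _).symm⟩

theorem faceNext_faceNext_mem_rowEdges {x : D} (hz : G.gonality (G.leftFace z) = 3)
    (hj : G.gonality (G.leftFace ((G.across ^ j) (G.inv z))) = 3)
    (h4 : G.gonality (G.leftFace x) = 4) (hx : x ∈ G.rowEdges z j) :
    G.faceNext (G.faceNext x) ∈ G.rowEdges z j := by
  obtain ⟨i, hi, rfl | rfl⟩ := hx
  · have hij : i ≠ j := by
      rintro rfl
      omega
    refine ⟨i + 1, by omega, Or.inr ?_⟩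
    rw [pow_succ', Perm.mul_apply, inv_across]
  · rcases i with - | i
    · rw [pow_zero, Perm.one_apply, inv_inv_apply] at h4
      omega
    · refine ⟨i, by omega, Or.inl ?_⟩
      rw [pow_succ', Perm.mul_apply, inv_across] at h4 ⊢
      rw [leftFace_faceNext, leftFace_faceNext] at h4
      rw [IsTriQuad.faceNext_four h4]

/-- A row borders 3-gons only at its two ends; this limits where the modified weight can differ on a
3-gon. -/
theorem eq_or_eq_of_mem_rowEdges {x : D}
    (hj : ∀ i < j, G.gonality (G.leftFace ((G.across ^ i) (G.inv z))) = 4)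
    (h3 : G.gonality (G.leftFace x) = 3) (hx : x ∈ G.rowEdges z j) :
    x = z ∨ x = (G.across ^ j) (G.inv z) := by
  obtain ⟨i, hi, rfl | rfl⟩ := hx
  · rcases hi.lt_or_eq with hi | rfl
    · have := hj i hi
      omega
    · exact Or.inr rfl
  · rcases i with - | i
    · exact Or.inl (inv_inv_apply G _)
    · rw [pow_succ', Perm.mul_apply, inv_across, leftFace_faceNext, leftFace_faceNext] at h3
      have := hj i (by omega)
      omega

end rowEdges

/-- On 3-gons the numbers of crossings determine the numbers of strands around the corners. -/
theorem two_mul_apply {d : D} (h3 : G.gonality (G.leftFace d) = 3) :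
    2 * k d + G.width k d = G.width k (G.faceNext d) + G.width k (G.facePrev d) := by
  have e1 := faceNext_faceNext_three h3
  rw [width, width, width, facePrev_faceNext, faceNext_facePrev, e1, IsTriQuad.facePrev_three h3]
  omega

/-- If a 3-gon is joined to two other 3-gons by rows of 4-gons, doubling one of these rows leads
to a family of strands that is not parallel to central circuits. -/
theorem exists_isWeight_of_faceNext (h : G.IsTriQuad) {z y y' : D}
    (hz : G.gonality (G.leftFace z) = 3) (hy : G.gonality (G.leftFace y) = 3)
    (hy' : G.gonality (G.leftFace y') = 3) (hr : G.IsRow z y) (hr' : G.IsRow (G.faceNext z) y')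
    (hne : G.leftFace y ≠ G.leftFace z) (hne' : G.leftFace y' ≠ G.leftFace z)
    (hyy : G.leftFace y ≠ G.leftFace y') : ∃ n, G.IsWeight n ∧ ¬ G.IsShadow n := by
  classical
  obtain ⟨j, rfl, hj⟩ := hr'
  set Z := G.rowEdges (G.faceNext z) j with hZ
  have hzf : G.gonality (G.leftFace (G.faceNext z)) = 3 := by rwa [leftFace_faceNext]
  -- The values 2 and 3 satisfy the triangle inequality on every 3-gon, wherever the row meets it.
  let N : D → ℕ := fun d => 2 + if d ∈ Z then 1 else 0
  have hN2 : ∀ d, 2 ≤ N d := fun d => Nat.le_add_right _ _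
  have hN3 : ∀ d, N d ≤ 3 := fun d => by
    simp only [N]
    split_ifs <;> omega
  have hNinv : ∀ d, N (G.inv d) = N d := fun d =>
    congrArg (2 + ·) (if_congr ⟨fun hd => by simpa using inv_mem_rowEdges hd, inv_mem_rowEdges⟩
      rfl rfl)
  have hNquad : ∀ d, G.gonality (G.leftFace d) = 4 → N (G.faceNext (G.faceNext d)) = N d := by
    intro d hd
    refine congrArg (2 + ·) (if_congr ⟨fun hx => ?_,
      faceNext_faceNext_mem_rowEdges hzf hy' hd⟩ rfl rfl)
    rw [← IsTriQuad.faceNext_four hd]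
    exact faceNext_faceNext_mem_rowEdges hzf hy' (by simpa using hd) hx
  have hNtri : ∀ d, G.gonality (G.leftFace d) = 3 → d ≠ G.faceNext z →
      G.leftFace d ≠ G.leftFace ((G.across ^ j) (G.inv (G.faceNext z))) → N d = 2 := by
    intro d hd hdz hdy
    simp only [N]
    rw [if_neg]
    intro hx
    rcases eq_or_eq_of_mem_rowEdges hj hd hx with h1 | h1
    · exact hdz h1
    · exact hdy (congrArg G.leftFace h1)
  -- The factor 2 settles the parity condition: the strand counts on 3-gons are `N (faceNext d) + N
  -- (facePrev d) - N d`.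
  refine ⟨fun d => 2 * N d, IsWeight.of_triangles h
    (κ := fun d => N (G.faceNext d) + N (G.facePrev d) - N d) (fun d => by rw [hNinv])
    (fun d hd => by rw [hNquad d hd]) (fun d hd => ?_), ?_⟩
  · have e1 := faceNext_faceNext_three hd
    rw [width]
    simp only [facePrev_faceNext, faceNext_facePrev, e1, IsTriQuad.facePrev_three hd]
    have := hN2 d
    have := hN2 (G.faceNext d)
    have := hN2 (G.facePrev d)
    have := hN3 (G.faceNext d)
    have := hN3 (G.facePrev d)
    omega
  · rintro ⟨f, hf, hN⟩
    have hN := fun d => congrFun hN d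
    -- For a shadow, `f` takes one value at `faceNext y` and `facePrev z`, the ends of a rail of the
    -- unmodified row. But the corner counts force `f (faceNext y) = N y` and `f (facePrev z) = N z
    -- + 1`, while `N y = N z`.
    have hrail := hr.apply_faceNext h hf
    have hNy := hr.apply_eq hNinv hNquad
    have hzp : G.gonality (G.leftFace (G.facePrev z)) = 3 := by rwa [leftFace_facePrev]
    have hyf : G.gonality (G.leftFace (G.faceNext y)) = 3 := by rwa [leftFace_faceNext]
    have h1 := two_mul_apply (k := f) hyf
    have h2 := two_mul_apply (k := f) hzp
    have e1 := faceNext_faceNext_three hy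
    rw [facePrev_faceNext, e1, ← hN, ← hN, ← hN] at h1
    rw [faceNext_facePrev, IsTriQuad.facePrev_three hz, ← hN, ← hN, ← hN] at h2
    have hne1 : ∀ d, G.leftFace d = G.leftFace y → d ≠ G.faceNext z := by
      rintro _ hd rfl
      rw [leftFace_faceNext] at hd
      exact hne hd.symm
    have n1 : N (G.faceNext y) = 2 :=
      hNtri _ hyf (hne1 _ (leftFace_faceNext G _)) (by rwa [leftFace_faceNext])
    have n2 : N (G.facePrev y) = 2 :=
      hNtri _ (by rwa [leftFace_facePrev]) (hne1 _ (leftFace_facePrev G _))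
        (by rwa [leftFace_facePrev])
    have n3 : N (G.facePrev z) = 2 := by
      refine hNtri _ hzp (fun e => ?_) (by rw [leftFace_facePrev]; exact hne'.symm)
      have e2 := congrArg G.faceNext e
      rw [faceNext_facePrev] at e2
      exact h.faceNext_faceNext_ne z e2.symm
    have n4 : N (G.faceNext z) = 3 := by
      simp only [N]
      rw [if_pos self_mem_rowEdges]
    omega

theorem exists_isWeight_not_isShadow (h : G.IsTriQuad) (hirr : G.IsIrreducible) {d : D}
    (hd : 3 ≤ (G.threeGonsLeftOf d).ncard) : ∃ n, G.IsWeight n ∧ ¬ G.IsShadow n := by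
  obtain ⟨_, _, _, ⟨hz, hy, z, y, rfl, rfl, hr⟩, ⟨-, hy', z', y', hzz, rfl, hr'⟩, hne, hne', hyy⟩ :=
    exists_rowAdj h hirr hd
  -- Rows leaving through the same edge end at the same 3-gon, so the two rows leave through
  -- consecutive edges, in one order or the other.
  rcases eq_or_eq_of_leftFace_eq hz hzz with rfl | rfl | rfl
  · exact absurd (congrArg G.leftFace (hr.unique hr' hy hy')) hyy
  · exact exists_isWeight_of_faceNext h hz hy hy' hr hr' hne hne' hyy
  · refine exists_isWeight_of_faceNext h (z := G.facePrev z) (by rwa [leftFace_facePrev]) hy' hy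
      hr' (by rwa [faceNext_facePrev]) ?_ ?_ hyy.symm
    · rwa [leftFace_facePrev]
    · rwa [leftFace_facePrev]

end PlaneGraph

end

/-- An irreducible 8-hedrite with three 3-gons on one side of a central circuit can be extended by
a central circuit to another irreducible 8-hedrite. -/
theorem mainTheorem11 {D : Type u} (G : PlaneGraph D) (hG : G.IsHedrite 8)
    (hirr : G.IsIrreducible) (C : Set D) (hC : G.IsCentralCircuit C)
    (hthree : ∃ d ∈ C, 3 ≤ (G.threeGonsLeftOf d).ncard) :
    ∃ (D' : Type u) (G' : PlaneGraph D') (C' : Set D') (f : D → D'),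
      G'.IsHedrite 8 ∧ G'.IsIrreducible ∧ G'.IsCentralCircuit C' ∧
        PlaneGraph.IsDeletion G' C' G f := by
  obtain ⟨d, -, hd⟩ := hthree
  have h := hG.isTriQuad
  obtain ⟨n, hn, hs⟩ := PlaneGraph.exists_isWeight_not_isShadow h hirr hd
  obtain ⟨k, hk⟩ := PlaneGraph.exists_isIndecomposable h hirr hn hs
  let s : G.Strands k := ⟨h, hk.balanced⟩
  exact ⟨_, s.graph, _, _, s.isHedrite hG.1 d, s.isIrreducible hk, s.isCentralCircuit hk,
    s.isDeletion⟩
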